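/- All matroids have finite ground sets. For a matroid $M$ on $E$ with rank function $\rho$, let $\mathcal B(M)$ be its set of bases. For an integer $g\ge 0$ let $\Lambda_1=\{1,\dots,g\}$ and $\Lambda_2=\binom{\Lambda_1}{2}$. Given $A_1,\dots,A_g\subseteq E$, attach to each label in the disjoint union $\Lambda^{(g)}$ of $\{i\mid i\in\Lambda_1\}$, $\{\cap\lambda\mid\lambda\in\Lambda_2\}$ and $\{\cup\lambda\mid\lambda\in\Lambda_2\}$ a set: to $i$ the set $A_i$, to $\cap\{i,j\}$ the set $A_i\cap A_j$, and to $\cup\{i,j\}$ the set $A_i\cup A_j$; write $A_\ell$ for the set attached to the label $\ell$. The genus-$g$ Tutte polynomial of $M$ is $$T^{(g)}(M)=\sum_{A_1,\dots,A_g\subseteq E}\ \prod_{\ell\in\Lambda^{(g)}}(x_\ell-1)^{\rho(E)-\rho(A_\ell)}\,(y_\ell-1)^{|A_\ell|-\rho(A_\ell)}\in\mathbb Z[x_\ell,y_\ell:\ell\in\Lambda^{(g)}],$$ and the genus-$g$ Whitney rank generating function $R^{(g)}(M)$ is obtained from $T^{(g)}(M)$ by replacing every variable $z$ by $z+1$.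 A matroid is non-separable if it is not the direct sum of two matroids on disjoint non-empty ground sets. **Theorem.** (1) Every matroid $M$ can be reconstructed up to isomorphism from its Tutte polynomial of genus $|\mathcal B(M)|$: if $N$ is any matroid with $T^{(|\mathcal B(M)|)}(N)=T^{(|\mathcal B(M)|)}(M)$, then $M\cong N$. In particular, for every $g\in\mathbb N$, $T^{(g)}$ is a complete invariant for the class of matroids with at most $g$ bases: if $|\mathcal B(M)|\le g$ and $|\mathcal B(N)|\le g$, then $T^{(g)}(M)=T^{(g)}(N)$ if and only if $M\cong N$. Likewise, every non-separable matroid $M$ can be reconstructed from its Whitney rank generating function of genus $|\mathcal B(M)|$: if $N$ is any matroid with $R^{(|\mathcal B(M)|)}(N)=R^{(|\mathcal B(M)|)}(M)$, then $M\cong N$. (2) For every positive integer $g$ there are matroids $M$ and $N$ such that $T^{(g)}(M)=T^{(g)}(N)$ and $T^{(\lceil\sqrt2\,g\rceil)}(M)\ne T^{(\lceil\sqrt2\,g\rceil)}(N)$. -/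

import Mathlib

universe u v

namespace GenusTutte

/-- Isomorphism of matroids: a bijection between the ground sets that preserves independence
in both directions. -/
def Iso {α : Type u} {β : Type v} (M : Matroid α) (N : Matroid β) : Prop :=
  ∃ φ : M.E ≃ N.E, ∀ I : Set M.E,
    M.Indep ((↑) '' I : Set α) ↔ N.Indep ((↑) '' (φ '' I) : Set β)

/-- `M` is separable: it is the direct sum of two matroids on disjoint nonempty ground sets. -/
def Separable {α : Type u} (M : Matroid α) : Prop :=
  ∃ (M₁ M₂ : Matroid α) (h : Disjoint M₁.E M₂.E),
    M₁.E.Nonempty ∧ M₂.E.Nonempty ∧ M = M₁.disjointSum M₂ h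

/-- The number of bases of `M`. -/
noncomputable def numBases {α : Type u} (M : Matroid α) : ℕ :=
  {B : Set α | M.IsBase B}.ncard

/-- The rank of a subset, as a natural number (`M` is finite wherever this is used). -/
noncomputable def rk {α : Type u} (M : Matroid α) (A : Set α) : ℕ :=
  (M.eRk A).toNat

/-- The two-element subsets `{i, j}` of `{1, …, g}`, each listed once, with `i < j`. -/
abbrev Pair (g : ℕ) : Type := {p : Fin g × Fin g // p.1 < p.2}

/-- The labels of the sets attached to a `g`-tuple: one for each `A i`, one for each
intersection `A i ∩ A j` and one for each union `A i ∪ A j`, for `i < j`. -/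
abbrev Label (g : ℕ) : Type := Fin g ⊕ (Pair g ⊕ Pair g)

/-- The set that a label denotes for a given `g`-tuple. -/
def setAt {α : Type u} {g : ℕ} (A : Fin g → Set α) : Label g → Set α
  | Sum.inl i => A i
  | Sum.inr (Sum.inl p) => A p.1.1 ∩ A p.1.2
  | Sum.inr (Sum.inr p) => A p.1.1 ∪ A p.1.2

/-- The variables in genus `g`: `x l` and `y l` for each label `l`. -/
inductive Var (g : ℕ) : Type
  | x (l : Label g) : Var g
  | y (l : Label g) : Var g

open MvPolynomial in
/-- The summand `T^(g)(A₁, …, A_g)`: the product over all labels of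
`(x_l - 1)^(ρ(E) - ρ(A_l)) (y_l - 1)^(|A_l| - ρ(A_l))`. -/
noncomputable def tutteTerm {α : Type u} (M : Matroid α) {g : ℕ} (A : Fin g → Set α) :
    MvPolynomial (Var g) ℤ :=
  ∏ l : Label g,
    (X (Var.x l) - 1) ^ (rk M M.E - rk M (setAt A l)) *
      (X (Var.y l) - 1) ^ ((setAt A l).ncard - rk M (setAt A l))

/-- The Tutte polynomial of genus `g` of a matroid on a finite ground set `E`: the sum of
`tutteTerm` over all `g`-tuples of subsets of `E`. -/
noncomputable def tutte {α : Type u} (g : ℕ) (M : Matroid α) [M.Finite] :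
    MvPolynomial (Var g) ℤ :=
  ∑ A ∈ Fintype.piFinset (fun _ : Fin g => M.ground_finite.toFinset.powerset),
    tutteTerm M (fun i => (A i : Set α))

open MvPolynomial in
/-- The Whitney rank generating function of genus `g`: the Tutte polynomial of genus `g` with
every variable `z` replaced by `z + 1`. -/
noncomputable def whitney {α : Type u} (g : ℕ) (M : Matroid α) [M.Finite] :
    MvPolynomial (Var g) ℤ :=
  bind₁ (fun z : Var g => (X z + 1 : MvPolynomial (Var g) ℤ)) (tutte g M)

end GenusTutte

namespace GenusTutte

open Set MvPolynomial

/-! Replacing each variable `z` by `z + 1` turns the term of a tuple into a monomial whose exponents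
are the coranks and nullities of the attached sets, so the coefficients of the Whitney function
count tuples. For positive genus `g` the rank of the ground set can be read off. Hence any family of
at most `g` subsets of `M` has a counterpart in `N` with the same sizes and ranks of all pairwise
intersections and unions (`exists_map_of_whitney_eq`). Moreover `N` has no more bases than `M`, so a
bijection of ground sets that sends bases of `M` to bases of `N` is an isomorphism (`iso_of_bijOn`).

Fix a base `B` of size `r`, and let `V` and `W` be the elements inside and outside `B` that take
part in some exchange. The family to transport consists of the sets `B \ {e}` for `e` in `V`, the
singletons of `W`, and all bases except some near `B`. At least `|V| + |W|` bases are left out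
(`ncard_le_ncard_nearBases`), so the number of bases is genus enough; those left out are recovered
by exchange (`isBase_double_exchange`).

When `|V| ≥ 2`, the images of the sets `B \ {e}` are `(r - 1)`-sets that meet pairwise in `r - 2`
elements. Such sets either lie in one `r`-set or share one `(r - 2)`-set. In the first case that
`r`-set is a base of `N`, each image omits one element of it, and this dictates the bijection. In
the second case, with at least three images, `N` would have more bases than `M`. The cases `|V| ≤ 1`
are direct.

For the lower bound, the even and the odd subsets of a `(g + 1)`-set, with two private elements per
index, carry sparse paving matroids whose circuit-hyperplane `H i` collects the subsets containing
`i` and the private elements of `i`. Flipping membership of `j` matches the two families except at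
`H j`, so a difference can only show where all `g + 1` circuit-hyperplanes occur together. In genus
`g` they never do (`exists_forall_setAt_ne`). With `g + 2` sets the matroids are told apart, because
the empty subset is an even element lying in no `H i`. This settles `g ≥ 3`; for `g = 1, 2` special
families of `g + 1` sets suffice. -/

theorem rk_empty {α : Type*} {M : Matroid α} : rk M ∅ = 0 := by simp [rk]

/-! ### Rank and bases of a finite matroid -/

section Rank

variable {α : Type*} {M : Matroid α} [M.Finite] {A B X Y I : Set α} {e f : α}

theorem eRk_ne_top_of_finite (A : Set α) : M.eRk A ≠ ⊤ :=
  ((M.eRk_le_eRank A).trans_lt (Matroid.eRank_lt_top_iff.2 inferInstance)).ne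

theorem coe_rk (A : Set α) : (rk M A : ℕ∞) = M.eRk A :=
  ENat.natCast_toNat (eRk_ne_top_of_finite A)

theorem rk_mono (h : X ⊆ Y) : rk M X ≤ rk M Y :=
  ENat.toNat_le_toNat (M.eRk_mono h) (eRk_ne_top_of_finite Y)

theorem rk_le_rk_ground (A : Set α) : rk M A ≤ rk M M.E := by
  have := M.eRk_le_eRank A
  rw [← M.eRk_ground, ← coe_rk, ← coe_rk] at this
  exact_mod_cast this

theorem finite_of_subset_ground (hA : A ⊆ M.E) : A.Finite := M.ground_finite.subset hA

theorem rk_le_ncard (hA : A ⊆ M.E) : rk M A ≤ A.ncard := by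
  have := M.eRk_le_encard A
  rw [← coe_rk, ← (finite_of_subset_ground hA).cast_ncard_eq] at this
  exact_mod_cast this

theorem indep_iff_rk (hA : A ⊆ M.E) : M.Indep A ↔ rk M A = A.ncard := by
  rw [M.indep_iff_eRk_eq_encard, ← coe_rk, ← (finite_of_subset_ground hA).cast_ncard_eq]
  norm_cast

theorem isBase_ncard (hB : M.IsBase B) : B.ncard = rk M M.E := by
  have := hB.encard_eq_eRank
  rw [← M.eRk_ground, ← coe_rk, ← (finite_of_subset_ground hB.subset_ground).cast_ncard_eq] at this
  exact_mod_cast this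

theorem isBase_iff_indep_ncard : M.IsBase B ↔ M.Indep B ∧ B.ncard = rk M M.E := by
  refine ⟨fun h => ⟨h.indep, isBase_ncard h⟩, fun ⟨h, hc⟩ => ?_⟩
  obtain ⟨B', hB', hBB'⟩ := h.exists_isBase_superset
  have : B = B' := eq_of_subset_of_ncard_le hBB' (by rw [hc, isBase_ncard hB'])
    (finite_of_subset_ground hB'.subset_ground)
  exact this ▸ hB'

theorem isBase_iff_rk (hB : B ⊆ M.E) :
    M.IsBase B ↔ rk M B = rk M M.E ∧ B.ncard = rk M M.E := by
  rw [isBase_iff_indep_ncard, indep_iff_rk hB]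
  constructor
  · rintro ⟨h1, h2⟩; exact ⟨h1.trans h2, h2⟩
  · rintro ⟨h1, h2⟩; exact ⟨h1.trans h2.symm, h2⟩

theorem rk_isBase (hB : M.IsBase B) : rk M B = rk M M.E :=
  ((isBase_iff_rk hB.subset_ground).1 hB).1

theorem setOf_isBase_finite (M : Matroid α) [M.Finite] : {B | M.IsBase B}.Finite :=
  M.ground_finite.finite_subsets.subset fun _ hB => hB.subset_ground

theorem numBases_pos (M : Matroid α) [M.Finite] : 0 < numBases M := by
  rw [numBases, ncard_pos (setOf_isBase_finite M)]
  exact M.exists_isBase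

end Rank

/-! ### What the Whitney rank generating function records -/

theorem setAt_subset {α : Type*} {g : ℕ} {A : Fin g → Set α} {E : Set α} (hA : ∀ i, A i ⊆ E) :
    ∀ l, setAt A l ⊆ E
  | Sum.inl i => hA i
  | Sum.inr (Sum.inl _) => inter_subset_left.trans (hA _)
  | Sum.inr (Sum.inr _) => union_subset (hA _) (hA _)

/-- The exponent vector of the term of a tuple in the Whitney rank generating function. -/
noncomputable def exponents {α : Type*} (M : Matroid α) {g : ℕ} (A : Fin g → Set α) :
    Var g →₀ ℕ :=
  ∑ l : Label g, (Finsupp.single (Var.x l) (rk M M.E - rk M (setAt A l)) +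
    Finsupp.single (Var.y l) ((setAt A l).ncard - rk M (setAt A l)))

section Exponents

variable {α : Type*} {β : Type*} {M : Matroid α} {N : Matroid β} {g : ℕ}

theorem exponents_x (A : Fin g → Set α) (l : Label g) :
    exponents M A (Var.x l) = rk M M.E - rk M (setAt A l) := by
  classical
  simp [exponents, Finsupp.single_apply, -Fintype.sum_sum_type, -Finsupp.single_tsub]

theorem exponents_y (A : Fin g → Set α) (l : Label g) :
    exponents M A (Var.y l) = (setAt A l).ncard - rk M (setAt A l) := by
  classical
  simp [exponents, Finsupp.single_apply, -Fintype.sum_sum_type, -Finsupp.single_tsub]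

theorem exponents_eq_iff {A : Fin g → Set α} {A' : Fin g → Set β} :
    exponents M A = exponents N A' ↔ ∀ l,
      rk M M.E - rk M (setAt A l) = rk N N.E - rk N (setAt A' l) ∧
      (setAt A l).ncard - rk M (setAt A l) = (setAt A' l).ncard - rk N (setAt A' l) := by
  constructor
  · intro h l
    rw [← exponents_x, ← exponents_x, ← exponents_y, ← exponents_y, h]
    exact ⟨rfl, rfl⟩
  · intro h
    unfold exponents
    exact Finset.sum_congr rfl fun l _ => by rw [(h l).1, (h l).2]

theorem bind₁_tutteTerm (M : Matroid α) (A : Fin g → Set α) :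
    bind₁ (fun z : Var g => (X z + 1 : MvPolynomial (Var g) ℤ)) (tutteTerm M A) =
      monomial (exponents M A) 1 := by
  simp only [tutteTerm, map_prod, map_mul, map_pow, map_sub, bind₁_X_right, map_one,
    add_sub_cancel_right, exponents, monomial_sum_one, X_pow_eq_monomial, monomial_mul, mul_one]

theorem whitney_eq [M.Finite] : whitney g M =
    ∑ A ∈ Fintype.piFinset (fun _ : Fin g => M.ground_finite.toFinset.powerset),
      monomial (exponents M (fun i => (A i : Set α))) 1 := by
  simp only [whitney, tutte, map_sum, bind₁_tutteTerm]

open Classical in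
theorem coeff_whitney [M.Finite] (m : Var g →₀ ℕ) : coeff m (whitney g M) =
    ((Fintype.piFinset (fun _ : Fin g => M.ground_finite.toFinset.powerset)).filter
      (fun A => exponents M (fun i => (A i : Set α)) = m)).card := by
  rw [whitney_eq, coeff_sum]
  simp only [coeff_monomial]
  rw [Finset.sum_boole]

theorem exists_finset_tuple [M.Finite] {A : Fin g → Set α} (hA : ∀ i, A i ⊆ M.E) :
    ∃ F ∈ Fintype.piFinset (fun _ : Fin g => M.ground_finite.toFinset.powerset),
      (fun i => (F i : Set α)) = A := by
  refine ⟨fun i => (finite_of_subset_ground (hA i)).toFinset, ?_, by simp⟩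
  simp only [Fintype.mem_piFinset, Finset.mem_powerset]
  intro i x hx
  simp only [Finite.mem_toFinset] at hx ⊢
  exact hA i hx

theorem subset_ground_of_mem_piFinset [M.Finite] {F : Fin g → Finset α}
    (hF : F ∈ Fintype.piFinset (fun _ : Fin g => M.ground_finite.toFinset.powerset)) (i : Fin g) :
    (F i : Set α) ⊆ M.E := by
  simp only [Fintype.mem_piFinset, Finset.mem_powerset] at hF
  intro x hx
  simpa using hF i hx

/-- Coefficients are counts, so nothing cancels: an exponent realised in `M` has a positive
coefficient and must be realised in `N`. -/
theorem exists_tuple_of_whitney_eq [M.Finite] [N.Finite] (h : whitney g N = whitney g M)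
    {A : Fin g → Set α} (hA : ∀ i, A i ⊆ M.E) :
    ∃ A' : Fin g → Set β, (∀ i, A' i ⊆ N.E) ∧ exponents M A = exponents N A' := by
  classical
  obtain ⟨F, hF, rfl⟩ := exists_finset_tuple hA
  have h1 := congrArg (coeff (exponents M fun i => (F i : Set α))) h
  rw [coeff_whitney, coeff_whitney, Nat.cast_inj] at h1
  have h2 : 0 < ((Fintype.piFinset (fun _ : Fin g => M.ground_finite.toFinset.powerset)).filter
      (fun A => exponents M (fun i => (A i : Set α)) =
        exponents M fun i => (F i : Set α))).card :=
    Finset.card_pos.2 ⟨F, by simp only [Finset.mem_filter]; exact ⟨hF, trivial⟩⟩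
  rw [← h1, Finset.card_pos] at h2
  obtain ⟨F', hF'⟩ := h2
  rw [Finset.mem_filter] at hF'
  exact ⟨fun i => F' i, subset_ground_of_mem_piFinset hF'.1, hF'.2.symm⟩

/-- The tuple of empty sets has the full rank of `M` as an `x`-exponent, and no `x`-exponent in `N`
exceeds the rank of `N`. -/
theorem rk_ground_le_of_whitney_eq [M.Finite] [N.Finite] (hg : 0 < g)
    (h : whitney g N = whitney g M) : rk M M.E ≤ rk N N.E := by
  obtain ⟨A', -, h2⟩ := exists_tuple_of_whitney_eq h (A := fun _ => ∅) (fun _ => empty_subset _)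
  have := ((exponents_eq_iff.1 h2) (Sum.inl ⟨0, hg⟩)).1
  simp only [setAt, rk_empty] at this
  omega

theorem rk_ground_eq_of_whitney_eq [M.Finite] [N.Finite] (hg : 0 < g)
    (h : whitney g N = whitney g M) : rk N N.E = rk M M.E :=
  le_antisymm (rk_ground_le_of_whitney_eq hg h.symm) (rk_ground_le_of_whitney_eq hg h)

/-- With the rank of the ground set known, corank and nullity determine rank and size. The truncated
subtractions lose nothing, since a rank is at most the full rank and at most the size. -/
theorem exists_tuple_rk_ncard [M.Finite] [N.Finite] (hg : 0 < g)
    (h : whitney g N = whitney g M) {A : Fin g → Set α} (hA : ∀ i, A i ⊆ M.E) :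
    ∃ A' : Fin g → Set β, (∀ i, A' i ⊆ N.E) ∧ ∀ l,
      rk N (setAt A' l) = rk M (setAt A l) ∧ (setAt A' l).ncard = (setAt A l).ncard := by
  obtain ⟨A', hA', h2⟩ := exists_tuple_of_whitney_eq h hA
  refine ⟨A', hA', fun l => ?_⟩
  have h3 := exponents_eq_iff.1 h2 l
  have := rk_ground_eq_of_whitney_eq hg h
  have h4 := rk_le_rk_ground (M := M) (setAt A l)
  have h5 := rk_le_rk_ground (M := N) (setAt A' l)
  have h6 := rk_le_ncard (setAt_subset hA l)
  have h7 := rk_le_ncard (setAt_subset hA' l)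
  omega

theorem ncard_ground_le_of_whitney_eq [M.Finite] [N.Finite] (hg : 0 < g)
    (h : whitney g N = whitney g M) : M.E.ncard ≤ N.E.ncard := by
  obtain ⟨A', hA', h2⟩ := exists_tuple_rk_ncard hg h (A := fun _ => M.E) (fun _ => subset_rfl)
  have := (h2 (Sum.inl ⟨0, hg⟩)).2
  simp only [setAt] at this
  rw [← this]
  exact ncard_le_ncard (hA' _) N.ground_finite

theorem ncard_ground_eq_of_whitney_eq [M.Finite] [N.Finite] (hg : 0 < g)
    (h : whitney g N = whitney g M) : N.E.ncard = M.E.ncard :=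
  le_antisymm (ncard_ground_le_of_whitney_eq hg h.symm) (ncard_ground_le_of_whitney_eq hg h)

/-- The tuple `(B, ∅, …, ∅)`. -/
def headTuple (g : ℕ) (B : Set α) (i : Fin g) : Set α := if i.1 = 0 then B else ∅

theorem rk_setAt_headTuple [M.Finite] [N.Finite] {B : Set α} {B' : Set β}
    (hr : rk N B' = rk M B) (hc : B'.ncard = B.ncard) (l : Label g) :
    rk N (setAt (headTuple g B') l) = rk M (setAt (headTuple g B) l) ∧
      (setAt (headTuple g B') l).ncard = (setAt (headTuple g B) l).ncard := by
  match l with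
  | Sum.inl i =>
    by_cases h : i.1 = 0 <;> simp [setAt, headTuple, h, rk_empty, hr, hc]
  | Sum.inr (Sum.inl p) =>
    have : p.1.2.1 ≠ 0 := by have := p.2; rw [Fin.lt_def] at this; omega
    simp [setAt, headTuple, this, rk_empty]
  | Sum.inr (Sum.inr p) =>
    have : p.1.2.1 ≠ 0 := by have := p.2; rw [Fin.lt_def] at this; omega
    by_cases h : p.1.1.1 = 0 <;> simp [setAt, headTuple, this, h, rk_empty, hr, hc]

/-- The coefficient at the exponent of `(B, ∅, …, ∅)` is compared on both sides. In `M`, sizes and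
ranks force a counted tuple to be a base followed by empty sets; in `N`, every base yields such a
tuple. -/
theorem numBases_le_of_whitney_eq [M.Finite] [N.Finite] (hg : 0 < g)
    (h : whitney g N = whitney g M) : numBases N ≤ numBases M := by
  classical
  obtain ⟨B, hB⟩ := M.exists_isBase
  have hr := rk_ground_eq_of_whitney_eq hg h
  have h1 := congrArg (coeff (exponents M (headTuple g B))) h
  rw [coeff_whitney, coeff_whitney, Nat.cast_inj] at h1
  set SN := (Fintype.piFinset (fun _ : Fin g => N.ground_finite.toFinset.powerset)).filter
      (fun A => exponents N (fun i => (A i : Set β)) = exponents M (headTuple g B)) with hSN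
  set SM := (Fintype.piFinset (fun _ : Fin g => M.ground_finite.toFinset.powerset)).filter
      (fun A => exponents M (fun i => (A i : Set α)) = exponents M (headTuple g B)) with hSM
  have hNle : numBases N ≤ SN.card := by
    rw [numBases, ← ncard_coe_finset SN]
    have : {B' | N.IsBase B'} ⊆ (fun F : Fin g → Finset β => (F ⟨0, hg⟩ : Set β)) '' SN := by
      intro B' hB'
      have hsub : ∀ i, headTuple g B' i ⊆ N.E := by
        intro i
        unfold headTuple
        split_ifs
        exacts [hB'.subset_ground, empty_subset _]
      obtain ⟨F, hF, hFB⟩ := exists_finset_tuple hsub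
      refine ⟨F, ?_, by simpa [headTuple] using congrFun hFB ⟨0, hg⟩⟩
      rw [hSN, Finset.mem_coe, Finset.mem_filter]
      refine ⟨hF, ?_⟩
      rw [hFB, exponents_eq_iff]
      intro l
      have := rk_setAt_headTuple (g := g) (M := M) (N := N) (B := B) (B' := B')
        (by rw [rk_isBase hB, rk_isBase hB', hr])
        (by rw [isBase_ncard hB, isBase_ncard hB', hr]) l
      rw [this.1, this.2, hr]
      exact ⟨rfl, rfl⟩
    exact (ncard_le_ncard this (SN.finite_toSet.image _)).trans (ncard_image_le SN.finite_toSet)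
  have hMle : SM.card ≤ numBases M := by
    rw [numBases, ← ncard_coe_finset SM]
    have hval : ∀ F ∈ SM, (∀ i, (F i : Set α) ⊆ M.E) ∧ ∀ l,
        rk M (setAt (fun i => (F i : Set α)) l) = rk M (setAt (headTuple g B) l) ∧
        (setAt (fun i => (F i : Set α)) l).ncard = (setAt (headTuple g B) l).ncard := by
      intro F hF
      rw [hSM, Finset.mem_filter] at hF
      have h0 := subset_ground_of_mem_piFinset hF.1
      refine ⟨h0, fun l => ?_⟩
      have h2 := exponents_eq_iff.1 hF.2 l
      have hsub : ∀ i, headTuple g B i ⊆ M.E := by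
        intro i
        unfold headTuple
        split_ifs
        exacts [hB.subset_ground, empty_subset _]
      have h4 := rk_le_rk_ground (M := M) (setAt (fun i => (F i : Set α)) l)
      have h5 := rk_le_rk_ground (M := M) (setAt (headTuple g B) l)
      have h6 := rk_le_ncard (setAt_subset hsub l)
      have h7 := rk_le_ncard (setAt_subset h0 l)
      omega
    refine ncard_le_ncard_of_injOn (fun F : Fin g → Finset α => (F ⟨0, hg⟩ : Set α)) ?_ ?_
      (setOf_isBase_finite M)
    · intro F hF
      obtain ⟨h0, h2⟩ := hval F hF
      have h3 := h2 (Sum.inl ⟨0, hg⟩)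
      simp only [setAt, headTuple, if_true] at h3
      change M.IsBase _
      rw [isBase_iff_rk (h0 _), h3.1, h3.2]
      exact ⟨rk_isBase hB, isBase_ncard hB⟩
    · intro F hF F' hF' hFF'
      funext i
      by_cases hi : i.1 = 0
      · have : i = ⟨0, hg⟩ := Fin.ext hi
        rw [this]
        exact Finset.coe_injective hFF'
      · have aux : ∀ G ∈ SM, G i = ∅ := by
          intro G hG
          have h3 := ((hval G hG).2 (Sum.inl i)).2
          simpa [setAt, headTuple, hi] using h3
        rw [aux F hF, aux F' hF']
  omega

/-- This is the only form in which the polynomial enters the reconstruction: list the family as a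
tuple, and let `Φ` send each member to the corresponding entry of the matching tuple. -/
theorem exists_map_of_whitney_eq [M.Finite] [N.Finite] (hg : 0 < g)
    (h : whitney g N = whitney g M) {𝒜 : Set (Set α)} (hfin : 𝒜.Finite) (hcard : 𝒜.ncard ≤ g)
    (hsub : ∀ X ∈ 𝒜, X ⊆ M.E) :
    ∃ Φ : Set α → Set β, (∀ X ∈ 𝒜, Φ X ⊆ N.E) ∧ ∀ X ∈ 𝒜, ∀ Y ∈ 𝒜,
      (Φ X ∩ Φ Y).ncard = (X ∩ Y).ncard ∧ (Φ X ∪ Φ Y).ncard = (X ∪ Y).ncard ∧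
      rk N (Φ X ∩ Φ Y) = rk M (X ∩ Y) ∧ rk N (Φ X ∪ Φ Y) = rk M (X ∪ Y) := by
  classical
  obtain ⟨n, e, he⟩ : ∃ n, ∃ e : 𝒜 ≃ Fin n, n ≤ g := by
    have := hfin.to_subtype
    exact ⟨_, Finite.equivFin 𝒜, by rwa [← Nat.card_coe_set_eq] at hcard⟩
  -- Positions beyond the family are padded with the empty set.
  let A : Fin g → Set α := fun i => if hi : i.1 < n then (e.symm ⟨i, hi⟩ : Set α) else ∅
  have hA : ∀ i, A i ⊆ M.E := by
    intro i
    simp only [A]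
    split_ifs
    exacts [hsub _ (e.symm _).2, empty_subset _]
  obtain ⟨A', hA', hl⟩ := exists_tuple_rk_ncard hg h hA
  let idx : Set α → Fin g := fun X =>
    if hX : X ∈ 𝒜 then ⟨e ⟨X, hX⟩, (e ⟨X, hX⟩).2.trans_le he⟩ else ⟨0, hg⟩
  have hidx : ∀ X ∈ 𝒜, A (idx X) = X := by
    intro X hX
    simp [A, idx, hX]
  refine ⟨fun X => A' (idx X), fun X _ => hA' _, fun X hX Y hY => ?_⟩
  rcases lt_trichotomy (idx X) (idx Y) with hlt | heq | hlt
  · have h1 := hl (Sum.inr (Sum.inl ⟨(idx X, idx Y), hlt⟩))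
    have h2 := hl (Sum.inr (Sum.inr ⟨(idx X, idx Y), hlt⟩))
    simp only [setAt, hidx X hX, hidx Y hY] at h1 h2
    exact ⟨h1.2, h2.2, h1.1, h2.1⟩
  · have hXY : X = Y := by rw [← hidx X hX, heq, hidx Y hY]
    have h1 := hl (Sum.inl (idx X))
    subst hXY
    simp only [setAt, hidx X hX] at h1
    simp only [inter_self, union_self]
    exact ⟨h1.2, h1.2, h1.1, h1.1⟩
  · have h1 := hl (Sum.inr (Sum.inl ⟨(idx Y, idx X), hlt⟩))
    have h2 := hl (Sum.inr (Sum.inr ⟨(idx Y, idx X), hlt⟩))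
    simp only [setAt, hidx X hX, hidx Y hY] at h1 h2
    rw [inter_comm (A' _), union_comm (A' _), inter_comm X, union_comm X]
    exact ⟨h1.2, h2.2, h1.1, h2.1⟩

end Exponents

/-! ### From bijections to isomorphisms -/

/-- Taking images is injective on bases, so the bound on the number of bases of `N` makes every base
of `N` an image; independence is then containment in a base on both sides. -/
theorem iso_of_bijOn {α : Type*} {β : Type*} {M : Matroid α} {N : Matroid β} [M.Finite] [N.Finite]
    {ψ : α → β} (hψ : BijOn ψ M.E N.E) (hb : ∀ B, M.IsBase B → N.IsBase (ψ '' B))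
    (hle : numBases N ≤ numBases M) : Iso M N := by
  have himg : {B | N.IsBase B} = (ψ '' ·) '' {B | M.IsBase B} := by
    symm
    refine eq_of_subset_of_ncard_le ?_ ?_ (setOf_isBase_finite N)
    · rintro _ ⟨B, hB, rfl⟩
      exact hb B hB
    · rw [InjOn.ncard_image]
      · exact hle
      · intro B hB B' hB' h
        exact (hψ.injOn.image_eq_image_iff hB.subset_ground hB'.subset_ground).1 h
  refine ⟨hψ.equiv ψ, fun I => ?_⟩
  have hI : ((↑) '' ((hψ.equiv ψ) '' I) : Set β) = ψ '' ((↑) '' I) := by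
    simp only [image_image]
    rfl
  rw [hI]
  have hIE : ((↑) '' I : Set α) ⊆ M.E := Subtype.coe_image_subset _ _
  constructor
  · intro h
    obtain ⟨B, hB, hIB⟩ := h.exists_isBase_superset
    exact (hb B hB).indep.subset (image_mono hIB)
  · intro h
    obtain ⟨B', hB', hIB⟩ := h.exists_isBase_superset
    have hB'2 : B' ∈ {B | N.IsBase B} := hB'
    rw [himg] at hB'2
    obtain ⟨B, hB, rfl⟩ := hB'2
    have : ((↑) '' I : Set α) ⊆ B :=
      (hψ.injOn.image_subset_image_iff hIE hB.subset_ground).1 hIB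
    exact hB.indep.subset this

theorem iso_of_ground_eq_empty {α : Type*} {β : Type*} {M : Matroid α} {N : Matroid β}
    (hM : M.E = ∅) (hN : N.E = ∅) : Iso M N := by
  have h1 : IsEmpty M.E := isEmpty_coe_sort.2 hM
  have h2 : IsEmpty N.E := isEmpty_coe_sort.2 hN
  refine ⟨Equiv.equivOfIsEmpty _ _, fun I => ?_⟩
  rw [Set.eq_empty_of_isEmpty I]
  simp

/-- Only the image of `K` as a set matters, so any bijections of `K` and of the remaining elements
can be glued to `θ`. -/
theorem exists_bijOn_extending {α : Type*} {β : Type*} [Nonempty β] {E U K : Set α} {E' K' : Set β}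
    {θ : α → β} (hE : E.Finite) (hE' : E'.Finite) (hU : U ⊆ E) (hK : K ⊆ E) (hUK : Disjoint U K)
    (hθ : InjOn θ U) (hθE : θ '' U ⊆ E') (hK' : K' ⊆ E') (hdisj : Disjoint (θ '' U) K')
    (hcK : K.ncard = K'.ncard) (hcE : E.ncard = E'.ncard) :
    ∃ ψ : α → β, BijOn ψ E E' ∧ EqOn ψ θ U ∧ ψ '' K = K' := by
  classical
  have hUf := hE.subset hU
  have hKf := hE.subset hK
  have hK'f := hE'.subset hK'
  have hUKE : U ∪ K ⊆ E := union_subset hU hK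
  have hUKE' : θ '' U ∪ K' ⊆ E' := union_subset hθE hK'
  have hc : (E \ (U ∪ K)).ncard = (E' \ (θ '' U ∪ K')).ncard := by
    rw [ncard_sdiff hUKE (hUf.union hKf), ncard_sdiff hUKE' ((hUf.image _).union hK'f),
      ncard_union_eq hUK hUf hKf, ncard_union_eq hdisj (hUf.image _) hK'f,
      hθ.ncard_image, hcK, hcE]
  have encard_of {γ δ : Type _} {s : Set γ} {t : Set δ} (hs : s.Finite) (ht : t.Finite)
      (h : s.ncard = t.ncard) : s.encard = t.encard := by
    rw [← hs.cast_ncard_eq, ← ht.cast_ncard_eq, h]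
  obtain ⟨f, hf⟩ := hKf.exists_bijOn_of_encard_eq (encard_of hKf hK'f hcK)
  obtain ⟨h, hh⟩ := (hE.sdiff (t := U ∪ K)).exists_bijOn_of_encard_eq
    (encard_of hE.sdiff hE'.sdiff hc)
  let ψ : α → β := fun x => if x ∈ U then θ x else if x ∈ K then f x else h x
  have h1 : EqOn ψ θ U := fun x hx => by simp [ψ, hx]
  have h2 : EqOn ψ f K := fun x hx => by
    have : x ∉ U := fun hxU => disjoint_left.1 hUK hxU hx
    simp [ψ, hx, this]
  have h3 : EqOn ψ h (E \ (U ∪ K)) := fun x hx => by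
    have h4 : x ∉ U := fun h => hx.2 (Or.inl h)
    have h5 : x ∉ K := fun h => hx.2 (Or.inr h)
    simp [ψ, h4, h5]
  have b1 : BijOn ψ U (θ '' U) := hθ.bijOn_image.congr h1.symm
  have b2 : BijOn ψ K K' := hf.congr h2.symm
  have b3 := hh.congr h3.symm
  have b12 : BijOn ψ (U ∪ K) (θ '' U ∪ K') := by
    refine b1.union b2 ?_
    rw [injOn_union hUK]
    refine ⟨b1.injOn, b2.injOn, fun a ha b hb hab => ?_⟩
    exact disjoint_left.1 hdisj (b1.mapsTo ha) (hab ▸ b2.mapsTo hb)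
  refine ⟨ψ, ?_, h1, b2.image_eq⟩
  have b123 := b12.union b3 (by
    rw [injOn_union disjoint_sdiff_right]
    refine ⟨b12.injOn, b3.injOn, fun a ha b hb hab => ?_⟩
    exact (b3.mapsTo hb).2 (hab ▸ b12.mapsTo ha))
  rwa [union_sdiff_cancel hUKE, union_sdiff_cancel hUKE'] at b123

/-! ### Base exchange -/

section Exchange

variable {α : Type*} {M : Matroid α} {B X D : Set α} {e f x y u v : α}

theorem exists_exchange_of_notMem (hB : M.IsBase B) (hX : M.IsBase X) (he : e ∈ B \ X) :
    ∃ f ∈ M.E \ B, M.IsBase (insert f (B \ {e})) := by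
  obtain ⟨f, hf, h⟩ := hB.exchange hX he
  exact ⟨f, ⟨hX.subset_ground hf.1, hf.2⟩, h⟩

/-- Extend `{f}` to a base inside `{f} ∪ B`; an element of `B` missing from it can only be exchanged
for `f`. -/
theorem exists_exchange_of_indep_singleton (hB : M.IsBase B) (hf : M.Indep {f}) (hfB : f ∉ B) :
    ∃ e ∈ B, M.IsBase (insert f (B \ {e})) := by
  obtain ⟨B', hB', hsub, hsup⟩ := hf.exists_isBase_subset_union_isBase hB
  have hfB' : f ∈ B' := hsub rfl
  have hne : (B \ B').Nonempty := by
    rw [nonempty_iff_ne_empty]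
    intro h
    have := hB.eq_of_subset_isBase hB' (sdiff_eq_empty.1 h)
    exact hfB (this ▸ hfB')
  obtain ⟨e, he⟩ := hne
  refine ⟨e, he.1, ?_⟩
  obtain ⟨f', hf', h⟩ := hB.exchange hB' he
  have : f' = f := by
    rcases hsup hf'.1 with h1 | h1
    · exact h1
    · exact absurd h1 hf'.2
  exact this ▸ h

/-- In the main case `D` has two elements fewer than a base, and the contraction by `D` has rank
two. There `v` is not a loop, because of `y`, and is parallel to `x`, while `u` is not parallel to
`x`; so `u` and `v` form a base. -/
theorem isBase_insert_insert (hxu : M.IsBase (insert u (insert x D)))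
    (hxv : ¬ M.IsBase (insert v (insert x D))) (hyv : M.IsBase (insert v (insert y D)))
    (hyD : y ∉ D) (hvy : v ≠ y) : M.IsBase (insert u (insert v D)) := by
  have hI : M.Indep (insert v D) :=
    hyv.indep.subset (insert_subset_insert (subset_insert _ _))
  have hyvD : y ∉ insert v D := by
    rintro (h | h)
    exacts [hvy h.symm, hyD h]
  have hyv' : M.IsBase (insert y (insert v D)) := insert_comm v y D ▸ hyv
  have hnb : ¬ M.IsBase (insert v D) := fun h =>
    hyvD (h.eq_of_subset_isBase hyv' (subset_insert _ _) ▸ mem_insert _ _)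
  obtain ⟨z, hz, hzI⟩ := hI.exists_insert_of_not_isBase hnb hxu
  have hzB := Matroid.insert_isBase_of_insert_indep hyvD hz.2 hyv' hzI
  rcases hz.1 with rfl | rfl | h
  · exact hzB
  · exact absurd (insert_comm z v D ▸ hzB) hxv
  · exact absurd (Or.inr h) hz.2

end Exchange

/-! ### Exchangeable elements and the bases near `B` -/

section Exchangeable

variable {α : Type*} {M : Matroid α} {B X : Set α} {e e' f f' : α}

/-- The elements of the base `B` that can be exchanged for an element outside `B`. -/
def removable (M : Matroid α) (B : Set α) : Set α :=
  {e | e ∈ B ∧ ∃ f ∈ M.E \ B, M.IsBase (insert f (B \ {e}))}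

/-- The elements outside the base `B` that can be exchanged for an element of `B`. -/
def addable (M : Matroid α) (B : Set α) : Set α :=
  {f | f ∈ M.E \ B ∧ ∃ e ∈ B, M.IsBase (insert f (B \ {e}))}

theorem sdiff_subset_removable (hB : M.IsBase B) (hX : M.IsBase X) : B \ X ⊆ removable M B :=
  fun _ he => ⟨he.1, exists_exchange_of_notMem hB hX he⟩

theorem sdiff_subset_addable (hB : M.IsBase B) (hX : M.IsBase X) : X \ B ⊆ addable M B :=
  fun _ hf => ⟨⟨hX.subset_ground hf.1, hf.2⟩, exists_exchange_of_indep_singleton hB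
    (hX.indep.subset (singleton_subset_iff.2 hf.1)) hf.2⟩

theorem removable_subset : removable M B ⊆ B := fun _ h => h.1

theorem addable_subset : addable M B ⊆ M.E \ B := fun _ h => h.1

theorem mem_removable_of_isBase (he : e ∈ B) (hf : f ∈ M.E \ B)
    (h : M.IsBase (insert f (B \ {e}))) : e ∈ removable M B := ⟨he, f, hf, h⟩

theorem mem_addable_of_isBase (he : e ∈ B) (hf : f ∈ M.E \ B)
    (h : M.IsBase (insert f (B \ {e}))) : f ∈ addable M B := ⟨hf, e, he, h⟩

theorem sdiff_insert_sdiff (he : e ∈ B) (hf : f ∉ B) : B \ insert f (B \ {e}) = {e} := by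
  ext x
  simp only [mem_sdiff, mem_insert_iff, mem_singleton_iff]
  grind

theorem insert_sdiff_sdiff (hf : f ∉ B) : insert f (B \ {e}) \ B = {f} := by
  ext x
  simp only [mem_sdiff, mem_insert_iff, mem_singleton_iff]
  grind

/-- The conclusion follows from two exchanges and one failed exchange. These facts pass to `N`, so
this base need not be transported itself. -/
theorem isBase_double_exchange (he : e ∈ B) (he' : e' ∈ B) (hf' : f' ∉ B)
    (h : M.IsBase (insert f (B \ {e}))) (hn : ¬ M.IsBase (insert f' (B \ {e})))
    (h' : M.IsBase (insert f' (B \ {e'}))) :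
    M.IsBase (insert f (insert f' (B \ {e, e'}))) := by
  have hne : e ≠ e' := by rintro rfl; exact hn h'
  have h1 : insert e' (B \ {e, e'}) = B \ {e} := by
    ext x; simp only [mem_sdiff, mem_insert_iff, mem_singleton_iff]; grind
  have h2 : insert e (B \ {e, e'}) = B \ {e'} := by
    ext x; simp only [mem_sdiff, mem_insert_iff, mem_singleton_iff]; grind
  refine isBase_insert_insert (x := e') (y := e) (by rwa [h1]) (by rwa [h1]) (by rwa [h2])
    (by simp) ?_
  rintro rfl
  exact hf' he

/-- The bases at distance at most one from `B`, and the bases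
`B - e₁ - d f + f₁ + f` for those `f` that cannot be exchanged for `e₁`. -/
def nearBases (M : Matroid α) (B : Set α) (e₁ f₁ : α) (d : α → α) : Set (Set α) :=
  {X | X = B ∨ (∃ e ∈ removable M B, ∃ f ∈ addable M B,
      X = insert f (B \ {e}) ∧ M.IsBase (insert f (B \ {e}))) ∨
    ∃ f ∈ addable M B, ¬ M.IsBase (insert f (B \ {e₁})) ∧
      X = insert f₁ (insert f (B \ {e₁, d f}))}

variable {e₁ f₁ : α} {d : α → α}

theorem nearBases_subset (hB : M.IsBase B) (he₁ : e₁ ∈ B)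
    (h₁ : M.IsBase (insert f₁ (B \ {e₁})))
    (hd : ∀ f ∈ addable M B, d f ∈ B ∧ M.IsBase (insert f (B \ {d f}))) :
    nearBases M B e₁ f₁ d ⊆ {X | M.IsBase X} := by
  rintro X (rfl | ⟨e, he, f, hf, rfl, h⟩ | ⟨f, hf, hn, rfl⟩)
  · exact hB
  · exact h
  · exact isBase_double_exchange he₁ (hd f hf).1 (addable_subset hf).2 h₁ hn (hd f hf).2

theorem two_le_ncard_sdiff [M.Finite] (hB : M.IsBase B) (hX : M.IsBase X)
    (hXn : X ∉ nearBases M B e₁ f₁ d) : 2 ≤ (B \ X).ncard := by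
  have hfin : (B \ X).Finite := (finite_of_subset_ground hB.subset_ground).sdiff
  by_contra! hlt
  rcases Nat.lt_succ_iff_lt_or_eq.1 hlt with h0 | h1
  · have : B \ X = ∅ := by rw [← ncard_eq_zero hfin]; omega
    exact hXn (Or.inl (hB.eq_of_subset_isBase hX (sdiff_eq_empty.1 this)).symm)
  · obtain ⟨e, he⟩ := ncard_eq_one.1 h1
    obtain ⟨f, hf, hXe⟩ := hB.eq_exchange_of_sdiff_eq_singleton hX he
    have heB : e ∈ B \ X := he ▸ mem_singleton e
    have hXe' : X = insert f (B \ {e}) := by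
      rw [hXe, insert_sdiff_of_notMem]
      rintro rfl
      exact hf.2 heB.1
    exact hXn (Or.inr (Or.inl ⟨e, sdiff_subset_removable hB hX heB, f,
      sdiff_subset_addable hB hX hf, hXe', hXe' ▸ hX⟩))

/-- This pays for the sets `B \ {e}` and `{f}`: leaving out the near bases frees enough places in a
tuple whose length is the number of bases. -/
theorem ncard_le_ncard_nearBases [M.Finite] (hB : M.IsBase B) (he₁ : e₁ ∈ B)
    (hf₁ : f₁ ∈ M.E \ B) (h₁ : M.IsBase (insert f₁ (B \ {e₁})))
    (hd : ∀ f ∈ addable M B, d f ∈ B ∧ M.IsBase (insert f (B \ {d f}))) :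
    (removable M B ∪ addable M B).ncard ≤ (nearBases M B e₁ f₁ d).ncard := by
  classical
  have hc : ∀ e, ∃ f, e ∈ removable M B → f ∈ M.E \ B ∧ M.IsBase (insert f (B \ {e})) := by
    intro e
    by_cases he : e ∈ removable M B
    · obtain ⟨f, hf, h⟩ := he.2
      exact ⟨f, fun _ => ⟨hf, h⟩⟩
    · exact ⟨e, fun h => absurd h he⟩
  choose c hc using hc
  -- `e₁` pays with `B` itself, any other removable `x` with one of its exchanges, and an addable
  -- `x` with its exchange against `e₁`, or with the double exchange if that fails.
  let κ : α → Set α := fun x => if x = e₁ then B else if x ∈ B then insert (c x) (B \ {x}) else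
    if M.IsBase (insert x (B \ {e₁})) then insert x (B \ {e₁}) else
      insert f₁ (insert x (B \ {e₁, d x}))
  have κ1 : κ e₁ = B := by simp [κ]
  have κ2 : ∀ x ∈ removable M B, x ≠ e₁ → κ x = insert (c x) (B \ {x}) := fun x hx hne => by
    simp [κ, hne, hx.1]
  have κ3 : ∀ x ∈ addable M B, M.IsBase (insert x (B \ {e₁})) → κ x = insert x (B \ {e₁}) :=
    fun x hx h => by
      have h2 : x ∉ B := hx.1.2
      have h3 : x ≠ e₁ := by rintro rfl; exact h2 he₁
      simp [κ, h2, h3, h]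
  have κ4 : ∀ x ∈ addable M B, ¬ M.IsBase (insert x (B \ {e₁})) →
      κ x = insert f₁ (insert x (B \ {e₁, d x})) :=
    fun x hx h => by
      have h2 : x ∉ B := hx.1.2
      have h3 : x ≠ e₁ := by rintro rfl; exact h2 he₁
      simp [κ, h2, h3, h]
  refine ncard_le_ncard_of_injOn κ ?_ ?_
    ((setOf_isBase_finite M).subset (nearBases_subset hB he₁ h₁ hd))
  · rintro x (hx | hx)
    · by_cases hxe : x = e₁
      · rw [hxe, κ1]
        exact Or.inl rfl
      · rw [κ2 x hx hxe]
        obtain ⟨h1, h2⟩ := hc x hx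
        exact Or.inr (Or.inl ⟨x, hx, c x, mem_addable_of_isBase hx.1 h1 h2, rfl, h2⟩)
    · by_cases hxb : M.IsBase (insert x (B \ {e₁}))
      · rw [κ3 x hx hxb]
        exact Or.inr (Or.inl ⟨e₁, mem_removable_of_isBase he₁ hx.1 hxb, x, hx, rfl, hxb⟩)
      · rw [κ4 x hx hxb]
        exact Or.inr (Or.inr ⟨x, hx, hxb, rfl⟩)
  · -- the trace of `κ x` on `B` and off `B` determines `x`
    have t1 : κ e₁ \ B = ∅ := by simp [κ1]
    have t2 : ∀ x ∈ removable M B, x ≠ e₁ → B \ κ x = {x} ∧ κ x \ B = {c x} :=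
      fun x hx hne => by
        rw [κ2 x hx hne]
        exact ⟨sdiff_insert_sdiff hx.1 (hc x hx).1.2, insert_sdiff_sdiff (hc x hx).1.2⟩
    have t3 : ∀ x ∈ addable M B, M.IsBase (insert x (B \ {e₁})) →
        B \ κ x = {e₁} ∧ κ x \ B = {x} := fun x hx h => by
        rw [κ3 x hx h]
        exact ⟨sdiff_insert_sdiff he₁ hx.1.2, insert_sdiff_sdiff hx.1.2⟩
    have t4 : ∀ x ∈ addable M B, ¬ M.IsBase (insert x (B \ {e₁})) →
        κ x \ B = {f₁, x} ∧ x ≠ f₁ := fun x hx h => by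
        rw [κ4 x hx h]
        refine ⟨?_, by rintro rfl; exact h h₁⟩
        have h2 := hx.1.2
        have h3 := hf₁.2
        ext y
        simp only [mem_sdiff, mem_insert_iff, mem_singleton_iff]
        grind
    -- A double exchange has two elements outside `B`; the other values of `κ` have at most one.
    have key : ∀ x ∈ removable M B ∪ addable M B, ∀ y ∈ removable M B ∪ addable M B,
        κ x = κ y → y ∈ addable M B → ¬ M.IsBase (insert y (B \ {e₁})) → x = y := by
      intro x hx y _ hxy hya hyb
      obtain ⟨h5, h6⟩ := t4 y hya hyb
      rw [← hxy] at h5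
      have h7 : f₁ ∈ κ x \ B := by rw [h5]; simp
      have h8 : y ∈ κ x \ B := by rw [h5]; simp
      rcases hx with hx | hx
      · by_cases hxe : x = e₁
        · rw [hxe, t1] at h7; exact absurd h7 (notMem_empty _)
        · rw [(t2 x hx hxe).2, mem_singleton_iff] at h7 h8
          exact absurd (h8.trans h7.symm) h6
      · by_cases hxb : M.IsBase (insert x (B \ {e₁}))
        · rw [(t3 x hx hxb).2, mem_singleton_iff] at h7 h8
          exact absurd (h8.trans h7.symm) h6
        · rw [(t4 x hx hxb).1] at h8
          rcases h8 with h8 | h8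
          · exact absurd h8 h6
          · exact h8.symm
    intro x hx y hy hxy
    by_cases hya : y ∈ addable M B ∧ ¬ M.IsBase (insert y (B \ {e₁}))
    · exact key x hx y hy hxy hya.1 hya.2
    by_cases hxa : x ∈ addable M B ∧ ¬ M.IsBase (insert x (B \ {e₁}))
    · exact (key y hy x hx hxy.symm hxa.1 hxa.2).symm
    have norm : ∀ z ∈ removable M B ∪ addable M B,
        ¬ (z ∈ addable M B ∧ ¬ M.IsBase (insert z (B \ {e₁}))) →
        z = e₁ ∨ (z ∈ removable M B ∧ z ≠ e₁) ∨
          (z ∈ addable M B ∧ M.IsBase (insert z (B \ {e₁}))) := by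
      rintro z (hz | hz) hzn
      · by_cases hze : z = e₁
        · exact Or.inl hze
        · exact Or.inr (Or.inl ⟨hz, hze⟩)
      · exact Or.inr (Or.inr ⟨hz, by tauto⟩)
    have u1 : B \ κ e₁ = ∅ := by simp [κ1]
    have hx' := norm x hx hxa
    have hy' := norm y hy hya
    have sdx : B \ κ x = B \ κ y := by rw [hxy]
    have sdx' : κ x \ B = κ y \ B := by rw [hxy]
    rcases hx' with rfl | ⟨hx1, hx2⟩ | ⟨hx1, hx2⟩ <;> rcases hy' with rfl | ⟨hy1, hy2⟩ | ⟨hy1, hy2⟩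
    · rfl
    · rw [u1, (t2 y hy1 hy2).1] at sdx
      exact absurd sdx.symm (singleton_ne_empty _)
    · rw [u1, (t3 y hy1 hy2).1] at sdx
      exact absurd sdx.symm (singleton_ne_empty _)
    · rw [u1, (t2 x hx1 hx2).1] at sdx
      exact absurd sdx (singleton_ne_empty _)
    · rw [(t2 x hx1 hx2).1, (t2 y hy1 hy2).1] at sdx
      exact singleton_injective sdx
    · rw [(t2 x hx1 hx2).1, (t3 y hy1 hy2).1] at sdx
      exact absurd (singleton_injective sdx) hx2
    · rw [u1, (t3 x hx1 hx2).1] at sdx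
      exact absurd sdx (singleton_ne_empty _)
    · rw [(t3 x hx1 hx2).1, (t2 y hy1 hy2).1] at sdx
      exact absurd (singleton_injective sdx).symm hy2
    · rw [(t3 x hx1 hx2).2, (t3 y hy1 hy2).2] at sdx'
      exact singleton_injective sdx'

end Exchangeable

/-! ### Transporting the neighbourhood of `B` to `N` -/

/-- The images in `N` of the sets `B \ {e}`, `{f}` and of the bases in `R`, under a map that
preserves sizes and ranks of pairwise intersections and unions. -/
structure Shadow {α β : Type*} (M : Matroid α) (N : Matroid β) (B : Set α) (R : Set (Set α))
    (P : α → Set β) (θ : α → β) (Φ : Set α → Set β) : Prop where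
  subset_ground : ∀ e ∈ removable M B, P e ⊆ N.E
  ncard_add_one : ∀ e ∈ removable M B, (P e).ncard + 1 = rk N N.E
  ncard_inter : ∀ e ∈ removable M B, ∀ e' ∈ removable M B, e ≠ e' →
    (P e ∩ P e').ncard + 2 = rk N N.E
  isBase_union : ∀ e ∈ removable M B, ∀ e' ∈ removable M B, e ≠ e' → N.IsBase (P e ∪ P e')
  mem_ground : ∀ f ∈ addable M B, θ f ∈ N.E
  injOn : InjOn θ (addable M B)
  notMem : ∀ e ∈ removable M B, ∀ f ∈ addable M B, θ f ∉ P e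
  isBase_iff : ∀ e ∈ removable M B, ∀ f ∈ addable M B,
    (N.IsBase (insert (θ f) (P e)) ↔ M.IsBase (insert f (B \ {e})))
  isBase_map : ∀ X ∈ R, N.IsBase (Φ X)
  injOn_map : InjOn Φ R
  ncard_map_inter : ∀ X ∈ R, ∀ e ∈ removable M B, (Φ X ∩ P e).ncard = (X ∩ (B \ {e})).ncard
  mem_map_iff : ∀ X ∈ R, ∀ f ∈ addable M B, (θ f ∈ Φ X ↔ f ∈ X)

section

variable {α : Type*} {β : Type*} {M : Matroid α} {N : Matroid β} [N.Finite]
  {B : Set α} {R : Set (Set α)} {P : α → Set β} {θ : α → β} {Φ : Set α → Set β}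

theorem exists_shadow [M.Finite] [Nonempty β] {g : ℕ} (hg : 0 < g)
    (h : whitney g N = whitney g M) (hB : M.IsBase B)
    (hR : ∀ X ∈ R, M.IsBase X)
    (hcard : (removable M B ∪ addable M B).ncard + R.ncard ≤ g) :
    ∃ P θ Φ, Shadow M N B R P θ Φ := by
  have hBf : B.Finite := finite_of_subset_ground hB.subset_ground
  have hVf : (removable M B).Finite := hBf.subset removable_subset
  have hWf : (addable M B).Finite :=
    finite_of_subset_ground (addable_subset.trans sdiff_subset)
  have hRf : R.Finite := (setOf_isBase_finite M).subset hR
  have hr := rk_ground_eq_of_whitney_eq hg h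
  have hdisj : Disjoint (removable M B) (addable M B) :=
    disjoint_left.2 fun x h1 h2 => (addable_subset h2).2 (removable_subset h1)
  let 𝒜 : Set (Set α) := (fun e => B \ {e}) '' removable M B ∪ (fun f => {f}) '' addable M B ∪ R
  have h𝒜f : 𝒜.Finite := ((hVf.image _).union (hWf.image _)).union hRf
  have h𝒜c : 𝒜.ncard ≤ g := by
    refine le_trans ?_ hcard
    refine (ncard_union_le _ _).trans (Nat.add_le_add_right ?_ _)
    rw [ncard_union_eq hdisj hVf hWf]
    exact (ncard_union_le _ _).trans (Nat.add_le_add (ncard_image_le hVf) (ncard_image_le hWf))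
  have h𝒜s : ∀ X ∈ 𝒜, X ⊆ M.E := by
    rintro X ((⟨e, he, rfl⟩ | ⟨f, hf, rfl⟩) | hX)
    · exact sdiff_subset.trans hB.subset_ground
    · exact singleton_subset_iff.2 (addable_subset hf).1
    · exact (hR X hX).subset_ground
  obtain ⟨Φ, hΦ, hdata⟩ := exists_map_of_whitney_eq hg h h𝒜f h𝒜c h𝒜s
  have mV : ∀ e ∈ removable M B, B \ {e} ∈ 𝒜 := fun e he => Or.inl (Or.inl ⟨e, he, rfl⟩)
  have mW : ∀ f ∈ addable M B, ({f} : Set α) ∈ 𝒜 := fun f hf => Or.inl (Or.inr ⟨f, hf, rfl⟩)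
  have mR : ∀ X ∈ R, X ∈ 𝒜 := fun X hX => Or.inr hX
  have hsing : ∀ f, ∃ b, f ∈ addable M B → Φ {f} = {b} := by
    intro f
    by_cases hf : f ∈ addable M B
    · have := (hdata _ (mW f hf) _ (mW f hf)).1
      rw [inter_self, inter_self, ncard_singleton, ncard_eq_one] at this
      obtain ⟨b, hb⟩ := this
      exact ⟨b, fun _ => hb⟩
    · exact ⟨Classical.arbitrary β, fun h => absurd h hf⟩
  choose θ hθ using hsing
  refine ⟨fun e => Φ (B \ {e}), θ, Φ, ?_⟩
  have cB : B.ncard = rk N N.E := by rw [isBase_ncard hB, hr]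
  have c1 : ∀ e ∈ B, (B \ {e}).ncard + 1 = B.ncard := fun e he =>
    ncard_sdiff_singleton_add_one he hBf
  -- Membership of `f` is the size, 0 or 1, of the intersection with `{f}`.
  have hmem : ∀ X ∈ 𝒜, ∀ f ∈ addable M B, (θ f ∈ Φ X ↔ f ∈ X) := by
    intro X hX f hf
    have h1 := (hdata X hX _ (mW f hf)).1
    rw [hθ f hf] at h1
    constructor
    · intro hm
      by_contra hn
      rw [inter_singleton_eq_empty.2 hn, ncard_empty, inter_eq_self_of_subset_right
        (singleton_subset_iff.2 hm), ncard_singleton] at h1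
      exact one_ne_zero h1
    · intro hm
      by_contra hn
      rw [inter_singleton_eq_empty.2 hn, ncard_empty, inter_eq_self_of_subset_right
        (singleton_subset_iff.2 hm), ncard_singleton] at h1
      exact zero_ne_one h1
  have hbase : ∀ X ∈ 𝒜, ∀ Y ∈ 𝒜, (N.IsBase (Φ X ∪ Φ Y) ↔ M.IsBase (X ∪ Y)) := by
    intro X hX Y hY
    obtain ⟨-, h2, -, h4⟩ := hdata X hX Y hY
    rw [isBase_iff_rk (union_subset (hΦ X hX) (hΦ Y hY)),
      isBase_iff_rk (union_subset (h𝒜s X hX) (h𝒜s Y hY)), h2, h4, hr]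
  constructor
  · exact fun e he => hΦ _ (mV e he)
  · intro e he
    have := (hdata _ (mV e he) _ (mV e he)).1
    rw [inter_self, inter_self] at this
    rw [this, c1 e he.1, cB]
  · intro e he e' he' hne
    rw [(hdata _ (mV e he) _ (mV e' he')).1, ← cB, ← c1 e he.1,
      ← ncard_sdiff_singleton_add_one (s := B \ {e}) (a := e') ⟨he'.1, hne.symm⟩ hBf.sdiff]
    have : B \ {e} ∩ (B \ {e'}) = (B \ {e}) \ {e'} := by
      ext x; simp only [mem_inter_iff, mem_sdiff]; tauto
    rw [this]
  · intro e he e' he' hne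
    rw [hbase _ (mV e he) _ (mV e' he')]
    have : B \ {e} ∪ B \ {e'} = B := by
      ext x; simp only [mem_union, mem_sdiff, mem_singleton_iff]; grind
    rwa [this]
  · intro f hf
    have := hΦ _ (mW f hf)
    rwa [hθ f hf, singleton_subset_iff] at this
  · intro f hf f' hf' heq
    have := (hmem {f'} (mW f' hf') f hf).1 (by rw [hθ f' hf', heq]; rfl)
    exact this
  · intro e he f hf hm
    exact (addable_subset hf).2 ((hmem _ (mV e he) f hf).1 hm).1
  · intro e he f hf
    have := hbase _ (mW f hf) _ (mV e he)
    rw [hθ f hf, singleton_union, singleton_union] at this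
    exact this
  · intro X hX
    have := hbase _ (mR X hX) _ (mR X hX)
    rw [union_self, union_self] at this
    exact this.2 (hR X hX)
  · intro X hX Y hY hXY
    have h1 := (hdata _ (mR X hX) _ (mR Y hY)).1
    have h2 := (hdata _ (mR X hX) _ (mR X hX)).1
    rw [inter_self, inter_self] at h2
    rw [← hXY, inter_self, h2] at h1
    have hXf := finite_of_subset_ground (hR X hX).subset_ground
    have h3 : X ∩ Y = X := eq_of_subset_of_ncard_le inter_subset_left h1.le hXf
    exact (hR X hX).eq_of_subset_isBase (hR Y hY) (inter_eq_left.1 h3)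
  · exact fun X hX e he => (hdata _ (mR X hX) _ (mV e he)).1
  · exact fun X hX f hf => hmem X (mR X hX) f hf

/-- The classical dichotomy for `(r - 1)`-sets meeting pairwise in `r - 2` elements. A third set
that leaves `P e₁ ∪ P e₂` forces the common core on all of them. -/
theorem Shadow.subset_union_or_inter_subset (hS : Shadow M N B R P θ Φ) {e₁ e₂ : α}
    (h₁ : e₁ ∈ removable M B) (h₂ : e₂ ∈ removable M B) (hne : e₁ ≠ e₂) :
    (∀ e ∈ removable M B, P e ⊆ P e₁ ∪ P e₂) ∨
    ∃ e₃ ∈ removable M B, e₃ ≠ e₁ ∧ e₃ ≠ e₂ ∧ ∀ e ∈ removable M B, P e₁ ∩ P e₂ ⊆ P e := by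
  by_cases hall : ∀ e ∈ removable M B, P e ⊆ P e₁ ∪ P e₂
  · exact Or.inl hall
  right
  push Not at hall
  obtain ⟨e₃, h₃, hn₃⟩ := hall
  have hne31 : e₃ ≠ e₁ := by rintro rfl; exact hn₃ subset_union_left
  have hne32 : e₃ ≠ e₂ := by rintro rfl; exact hn₃ subset_union_right
  refine ⟨e₃, h₃, hne31, hne32, ?_⟩
  have fin : ∀ e ∈ removable M B, (P e).Finite := fun e he =>
    finite_of_subset_ground (hS.subset_ground e he)
  -- `P e₃` meets the union in at most `r - 2` elements, and already meets each of `P e₁` and `P e₂`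
  -- in that many.
  have hD3 : P e₁ ∩ P e₂ = P e₃ ∩ P e₁ := by
    have hlt : (P e₃ ∩ (P e₁ ∪ P e₂)).ncard < (P e₃).ncard :=
      ncard_lt_ncard (inter_subset_left.ssubset_of_ne fun h => hn₃ (inter_eq_left.1 h)) (fin _ h₃)
    have c := hS.ncard_add_one _ h₃
    have c31 := hS.ncard_inter _ h₃ _ h₁ hne31
    have c32 := hS.ncard_inter _ h₃ _ h₂ hne32
    have c12 := hS.ncard_inter _ h₁ _ h₂ hne
    have f3 : (P e₃ ∩ (P e₁ ∪ P e₂)).Finite := (fin _ h₃).inter_of_left _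
    have i1 : P e₃ ∩ P e₁ = P e₃ ∩ (P e₁ ∪ P e₂) :=
      eq_of_subset_of_ncard_le (inter_subset_inter_right _ subset_union_left) (by omega) f3
    have i2 : P e₃ ∩ P e₂ = P e₃ ∩ (P e₁ ∪ P e₂) :=
      eq_of_subset_of_ncard_le (inter_subset_inter_right _ subset_union_right) (by omega) f3
    symm
    refine eq_of_subset_of_ncard_le ?_ (by omega) ((fin _ h₁).inter_of_left _)
    intro x hx
    have : x ∈ P e₃ ∩ P e₂ := by rw [i2, ← i1]; exact hx
    exact ⟨hx.2, this.2⟩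
  -- If `P e` missed an element `d` of the core, it would contain `P e₁`, `P e₂` and `P e₃` apart
  -- from `d`: that is `r` elements in a set of size `r - 1`.
  intro e he d hd
  by_contra hde
  have key : ∀ i ∈ removable M B, d ∈ P i → P i \ {d} ⊆ P e := by
    intro i hi hdi
    have hei : e ≠ i := by rintro rfl; exact hde hdi
    have h1 : P e ∩ P i ⊆ P i \ {d} := fun x hx => ⟨hx.2, by rintro rfl; exact hde hx.1⟩
    have h2 := ncard_sdiff_singleton_add_one hdi (fin i hi)
    have h3 := hS.ncard_inter _ he _ hi hei
    have h4 := hS.ncard_add_one _ hi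
    have : P e ∩ P i = P i \ {d} := eq_of_subset_of_ncard_le h1 (by omega) (fin i hi).sdiff
    rw [← this]
    exact inter_subset_left
  have hd3 : d ∈ P e₃ := by rw [hD3] at hd; exact hd.1
  have k1 := key _ h₁ hd.1
  have k2 := key _ h₂ hd.2
  have k3 := key _ h₃ hd3
  obtain ⟨z, hz3, hz⟩ := not_subset.1 hn₃
  have hsub : insert z ((P e₁ ∪ P e₂) \ {d}) ⊆ P e := by
    refine insert_subset (k3 ⟨hz3, ?_⟩) ?_
    · rintro rfl; exact hz (Or.inl hd.1)
    · rw [union_sdiff_distrib]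
      exact union_subset k1 k2
  have hbase := hS.isBase_union _ h₁ _ h₂ hne
  have hfu : (P e₁ ∪ P e₂).Finite := (fin _ h₁).union (fin _ h₂)
  have c1 := ncard_le_ncard hsub (fin _ he)
  rw [ncard_insert_of_notMem (fun h => hz h.1) hfu.sdiff,
    ncard_sdiff_singleton_add_one (show d ∈ P e₁ ∪ P e₂ from Or.inl hd.1) hfu,
    isBase_ncard hbase] at c1
  have := hS.ncard_add_one _ he
  omega

end

/-! ### First case: the images lie in a common base -/

section

variable {α : Type*} {β : Type*} {M : Matroid α} {N : Matroid β} [M.Finite] [N.Finite]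
  {B : Set α} {P : α → Set β} {θ : α → β} {Φ : Set α → Set β}

theorem image_sdiff_of_injOn {ψ : α → β} {s t E : Set α} (h : InjOn ψ E) (hs : s ⊆ E) (ht : t ⊆ s) :
    ψ '' (s \ t) = ψ '' s \ ψ '' t :=
  (h.mono hs).image_sdiff_subset ht

/-- If all the sets `P e` lie in a common base, then `θ` extends to an isomorphism. -/
theorem Shadow.iso_of_subset [Nonempty β] {e₁ e₂ f₁ : α} {d : α → α}
    (hS : Shadow M N B ({X | M.IsBase X} \ nearBases M B e₁ f₁ d) P θ Φ)
    (hB : M.IsBase B) (hr : rk N N.E = rk M M.E) (hE : N.E.ncard = M.E.ncard)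
    (hle : numBases N ≤ numBases M) (he₁ : e₁ ∈ removable M B) (hf₁ : f₁ ∈ addable M B)
    (h₁ : M.IsBase (insert f₁ (B \ {e₁})))
    (hd : ∀ f ∈ addable M B, d f ∈ B ∧ M.IsBase (insert f (B \ {d f})))
    (he₂ : e₂ ∈ removable M B) (hne : e₁ ≠ e₂)
    (hsub : ∀ e ∈ removable M B, P e ⊆ P e₁ ∪ P e₂) : Iso M N := by
  classical
  set B' := P e₁ ∪ P e₂ with hB'def
  have hB' : N.IsBase B' := hS.isBase_union _ he₁ _ he₂ hne
  have hBf : B.Finite := finite_of_subset_ground hB.subset_ground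
  have hB'f : B'.Finite := finite_of_subset_ground hB'.subset_ground
  have hVf : (removable M B).Finite := hBf.subset removable_subset
  have cB' := isBase_ncard hB'
  have cB : B.ncard = rk N N.E := by rw [isBase_ncard hB, hr]
  -- `P e` is one element short of the base `B'`; the missing element `η e` plays the role of `e`.
  have hη : ∀ e, ∃ b, e ∈ removable M B → b ∈ B' ∧ P e = B' \ {b} := by
    intro e
    by_cases he : e ∈ removable M B
    · have h1 := ncard_sdiff_add_ncard_of_subset (hsub e he) hB'f
      have h2 := hS.ncard_add_one e he
      obtain ⟨b, hb⟩ := ncard_eq_one.1 (show (B' \ P e).ncard = 1 by omega)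
      refine ⟨b, fun _ => ⟨(hb ▸ mem_singleton b : b ∈ B' \ P e).1, ?_⟩⟩
      rw [← hb, sdiff_sdiff_cancel_left (hsub e he)]
    · exact ⟨Classical.arbitrary β, fun h => absurd h he⟩
  choose η hη using hη
  have ηmem : ∀ e ∈ removable M B, η e ∈ B' := fun e he => (hη e he).1
  have ηP : ∀ e ∈ removable M B, P e = B' \ {η e} := fun e he => (hη e he).2
  have ηinj : InjOn η (removable M B) := by
    intro e he e' he' heq
    by_contra hcon
    have h1 := hS.ncard_inter e he e' he' hcon
    have h2 := hS.ncard_add_one e he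
    rw [ηP e' he', ← heq, ← ηP e he, inter_self] at h1
    omega
  have θB' : ∀ f ∈ addable M B, θ f ∉ B' := by
    rintro f hf (h | h)
    exacts [hS.notMem _ he₁ f hf h, hS.notMem _ he₂ f hf h]
  let ζ : α → β := fun x => if x ∈ B then η x else θ x
  have ζV : ∀ e ∈ removable M B, ζ e = η e := fun e he => by simp [ζ, removable_subset he]
  have ζW : ∀ f ∈ addable M B, ζ f = θ f := fun f hf => by simp [ζ, (addable_subset hf).2]
  have hdVW : Disjoint (removable M B) (addable M B) :=
    disjoint_left.2 fun x h1 h2 => (addable_subset h2).2 (removable_subset h1)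
  have ζinj : InjOn ζ (removable M B ∪ addable M B) := by
    rw [injOn_union hdVW]
    refine ⟨ηinj.congr fun e he => (ζV e he).symm, hS.injOn.congr fun f hf => (ζW f hf).symm, ?_⟩
    intro e he f hf heq
    rw [ζV e he, ζW f hf] at heq
    exact θB' f hf (heq ▸ ηmem e he)
  have ηimg : η '' removable M B ⊆ B' := by
    rintro _ ⟨e, he, rfl⟩
    exact ηmem e he
  have ζimgV : ζ '' removable M B = η '' removable M B := image_congr ζV
  have ζimgW : ζ '' addable M B = θ '' addable M B := image_congr ζW
  obtain ⟨ψ, hψ, hψU, hψK⟩ := exists_bijOn_extending (E := M.E) (E' := N.E)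
    (U := removable M B ∪ addable M B) (K := B \ removable M B) (K' := B' \ η '' removable M B)
    (θ := ζ) M.ground_finite N.ground_finite
    (union_subset (removable_subset.trans hB.subset_ground) (addable_subset.trans sdiff_subset))
    (sdiff_subset.trans hB.subset_ground)
    (by
      rw [disjoint_union_left]
      exact ⟨disjoint_sdiff_right,
        disjoint_left.2 fun x h1 h2 => (addable_subset h1).2 h2.1⟩)
    ζinj
    (by
      rw [image_union, ζimgV, ζimgW]
      refine union_subset (ηimg.trans hB'.subset_ground) ?_
      rintro _ ⟨f, hf, rfl⟩
      exact hS.mem_ground f hf)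
    (sdiff_subset.trans hB'.subset_ground)
    (by
      rw [image_union, ζimgV, ζimgW, disjoint_union_left]
      refine ⟨disjoint_sdiff_right, disjoint_left.2 ?_⟩
      rintro _ ⟨f, hf, rfl⟩ h2
      exact θB' f hf h2.1)
    (by
      rw [ncard_sdiff removable_subset hVf, ncard_sdiff ηimg (hVf.image _), ηinj.ncard_image,
        cB, cB'])
    hE.symm
  have ψV : ∀ e ∈ removable M B, ψ e = η e := fun e he => by rw [hψU (Or.inl he), ζV e he]
  have ψW : ∀ f ∈ addable M B, ψ f = θ f := fun f hf => by rw [hψU (Or.inr hf), ζW f hf]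
  have ψB : ψ '' B = B' := by
    conv_lhs => rw [← union_sdiff_cancel (removable_subset (M := M) (B := B))]
    rw [image_union, hψK, image_congr ψV, union_sdiff_cancel ηimg]
  have ψP : ∀ e ∈ removable M B, ψ '' (B \ {e}) = P e := by
    intro e he
    rw [image_sdiff_of_injOn hψ.injOn hB.subset_ground
      (singleton_subset_iff.2 (removable_subset he)), ψB, image_singleton, ψV e he, ηP e he]
  refine iso_of_bijOn hψ (fun X hX => ?_) hle
  by_cases hXn : X ∈ nearBases M B e₁ f₁ d
  · rcases hXn with rfl | ⟨e, he, f, hf, rfl, h⟩ | ⟨f, hf, hn, rfl⟩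
    · rwa [ψB]
    · rw [image_insert_eq, ψP e he, ψW f hf]
      exact (hS.isBase_iff e he f hf).2 h
    · have hdV : d f ∈ removable M B :=
        mem_removable_of_isBase (hd f hf).1 (addable_subset hf) (hd f hf).2
      have hpair : ({e₁, d f} : Set α) ⊆ B := by
        rintro x (rfl | rfl)
        exacts [removable_subset he₁, removable_subset hdV]
      rw [image_insert_eq, image_insert_eq, image_sdiff_of_injOn hψ.injOn hB.subset_ground hpair,
        ψB, image_pair, ψW f hf, ψW f₁ hf₁, ψV e₁ he₁, ψV _ hdV]
      -- The double exchange is carried out in `N`, where its two exchanges and its failed exchange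
      -- have been transported.
      refine isBase_double_exchange (ηmem _ he₁) (ηmem _ hdV) (θB' f hf) ?_ ?_ ?_
      · rw [← ηP e₁ he₁]
        exact (hS.isBase_iff e₁ he₁ f₁ hf₁).2 h₁
      · rw [← ηP e₁ he₁, hS.isBase_iff e₁ he₁ f hf]
        exact hn
      · rw [← ηP _ hdV]
        exact (hS.isBase_iff _ hdV f hf).2 (hd f hf).2
  · have hXR : X ∈ {X | M.IsBase X} \ nearBases M B e₁ f₁ d := ⟨hX, hXn⟩
    have hY := hS.isBase_map X hXR
    set Y := Φ X with hYdef
    have hXf : X.Finite := finite_of_subset_ground hX.subset_ground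
    have hYf : Y.Finite := finite_of_subset_ground hY.subset_ground
    have hBX : B \ X ⊆ removable M B := sdiff_subset_removable hB hX
    have hXB : X \ B ⊆ addable M B := sdiff_subset_addable hB hX
    have cX : X.ncard = rk N N.E := by rw [isBase_ncard hX, hr]
    have cY : Y.ncard = rk N N.E := isBase_ncard hY
    have s1 := ncard_inter_add_ncard_sdiff_eq_ncard X B hXf
    have s2 := ncard_inter_add_ncard_sdiff_eq_ncard Y B' hYf
    have s3 := ncard_inter_add_ncard_sdiff_eq_ncard B X hBf
    have s4 := ncard_inter_add_ncard_sdiff_eq_ncard B' Y hB'f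
    rw [inter_comm] at s3 s4
    have hle1 : (X \ B).ncard ≤ (Y \ B').ncard := by
      refine ncard_le_ncard_of_injOn θ (fun f hf => ⟨?_, θB' f (hXB hf)⟩) (hS.injOn.mono hXB)
        hYf.sdiff
      exact (hS.mem_map_iff X hXR f (hXB hf)).2 hf.1
    have cnt1 : ∀ e ∈ removable M B, e ∈ X →
        (X ∩ (B \ {e})).ncard + 1 = (X ∩ B).ncard := fun e he heX => by
      rw [← inter_sdiff_assoc]
      exact ncard_sdiff_singleton_add_one ⟨heX, removable_subset he⟩ (hXf.inter_of_left _)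
    have cnt2 : ∀ e ∈ removable M B, e ∉ X →
        (X ∩ (B \ {e})).ncard = (X ∩ B).ncard := fun e he heX => by
      rw [← inter_sdiff_assoc, sdiff_singleton_eq_self fun h => heX h.1]
    have cnt3 : ∀ e ∈ removable M B, η e ∈ Y →
        (Y ∩ P e).ncard + 1 = (Y ∩ B').ncard := fun e he heY => by
      rw [ηP e he, ← inter_sdiff_assoc]
      exact ncard_sdiff_singleton_add_one ⟨heY, ηmem e he⟩ (hYf.inter_of_left _)
    have cnt4 : ∀ e ∈ removable M B, η e ∉ Y →
        (Y ∩ P e).ncard = (Y ∩ B').ncard := fun e he heY => by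
      rw [ηP e he, ← inter_sdiff_assoc, sdiff_singleton_eq_self fun h => heY h.1]
    -- By `hle1`, `Y` meets `B'` in no more elements than `X` meets `B`. Conversely, some `e` in `B
    -- \ X` exists since `X` is far from `B`, and `|X ∩ B| = |Y ∩ P e| ≤ |Y ∩ B'|`.
    have hte : (X ∩ B).ncard = (Y ∩ B').ncard := by
      obtain ⟨e, he⟩ : (B \ X).Nonempty := by
        have := two_le_ncard_sdiff hB hX hXn
        exact nonempty_of_ncard_ne_zero (by omega)
      have h2 := cnt2 e (hBX he) he.2
      have h3 := cnt3 e (hBX he)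
      have h4 := cnt4 e (hBX he)
      have h5 : (Y ∩ P e).ncard = (X ∩ (B \ {e})).ncard := hS.ncard_map_inter X hXR e (hBX he)
      by_cases heY : η e ∈ Y
      · have := h3 heY; omega
      · have := h4 heY; omega
    have hmem : ∀ e ∈ removable M B, (η e ∈ Y ↔ e ∈ X) := by
      intro e he
      have h5 : (Y ∩ P e).ncard = (X ∩ (B \ {e})).ncard := hS.ncard_map_inter X hXR e he
      constructor
      · intro heY
        by_contra heX
        have := cnt3 e he heY
        have := cnt2 e he heX
        omega
      · intro heX
        by_contra heY
        have := cnt4 e he heY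
        have := cnt1 e he heX
        omega
    -- By size, `Y` misses nothing else of `B'`; so it contains the images of the elements of `B`
    -- that are not removable.
    have hmiss : η '' (B \ X) = B' \ Y := by
      refine eq_of_subset_of_ncard_le ?_ ?_ hB'f.sdiff
      · rintro _ ⟨e, he, rfl⟩
        exact ⟨ηmem e (hBX he), fun h => he.2 ((hmem e (hBX he)).1 h)⟩
      · rw [(ηinj.mono hBX).ncard_image]
        omega
    have hsubY : ψ '' X ⊆ Y := by
      rintro _ ⟨x, hx, rfl⟩
      by_cases hxB : x ∈ B
      · by_cases hxV : x ∈ removable M B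
        · rw [ψV x hxV]
          exact (hmem x hxV).2 hx
        · have h1 : ψ x ∈ B' \ η '' removable M B := by
            rw [← hψK]
            exact mem_image_of_mem _ ⟨hxB, hxV⟩
          by_contra hcon
          have h2 : ψ x ∈ η '' (B \ X) := by
            rw [hmiss]
            exact ⟨h1.1, hcon⟩
          exact h1.2 (image_mono hBX h2)
      · have hxW := hXB ⟨hx, hxB⟩
        rw [ψW x hxW]
        exact (hS.mem_map_iff X hXR x hxW).2 hx
    have : ψ '' X = Y := by
      refine eq_of_subset_of_ncard_le hsubY ?_ hYf
      rw [(hψ.injOn.mono hX.subset_ground).ncard_image]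
      omega
    rw [this]
    exact hY

end

/-! ### Second case: the images share a common core -/

section

variable {α : Type*} {β : Type*} {M : Matroid α} {N : Matroid β} [M.Finite]
  {B : Set α} {P : α → Set β} {θ : α → β} {Φ : Set α → Set β}

/-- The pairs of elements that correspond to the bases in `nearBases` other than `B`. -/
def nearPairs (M : Matroid α) (B : Set α) (e₁ f₁ : α) : Set (Set α) :=
  {p | (∃ e ∈ removable M B, ∃ f ∈ addable M B,
      p = {e, f} ∧ M.IsBase (insert f (B \ {e}))) ∨
    ∃ f ∈ addable M B, ¬ M.IsBase (insert f (B \ {e₁})) ∧ p = {f₁, f}}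

theorem nearPairs_finite {e₁ f₁ : α} (hf₁ : f₁ ∈ addable M B) (hB : M.IsBase B) :
    (nearPairs M B e₁ f₁).Finite := by
  refine M.ground_finite.finite_subsets.subset ?_
  rintro p (⟨e, he, f, hf, rfl, -⟩ | ⟨f, hf, -, rfl⟩)
  · exact pair_subset (hB.subset_ground (removable_subset he)) (addable_subset hf).1
  · exact pair_subset (addable_subset hf₁).1 (addable_subset hf).1

/-- A near base other than `B` is determined by its pair: a pair meeting `B` gives a single
exchange, and a pair outside `B` gives a double one. -/
theorem ncard_nearBases_le {e₁ f₁ : α} {d : α → α} (hB : M.IsBase B)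
    (hf₁ : f₁ ∈ addable M B) (h₁ : M.IsBase (insert f₁ (B \ {e₁}))) :
    (nearBases M B e₁ f₁ d).ncard ≤ (nearPairs M B e₁ f₁).ncard + 1 := by
  classical
  let h : Set α → Set α := fun p => if (p ∩ B).Nonempty then p \ B ∪ B \ p else
    p ∪ (B \ insert e₁ (d '' (p \ {f₁})))
  have hsub : nearBases M B e₁ f₁ d ⊆ insert B (h '' nearPairs M B e₁ f₁) := by
    rintro X (rfl | ⟨e, he, f, hf, rfl, hb⟩ | ⟨f, hf, hn, rfl⟩)
    · exact Or.inl rfl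
    · refine Or.inr ⟨{e, f}, Or.inl ⟨e, he, f, hf, rfl, hb⟩, ?_⟩
      have h1 := removable_subset he
      have h2 := (addable_subset hf).2
      have : (({e, f} : Set α) ∩ B).Nonempty := ⟨e, by simp, h1⟩
      simp only [h, if_pos this]
      ext x
      simp only [mem_union, mem_sdiff, mem_insert_iff, mem_singleton_iff]
      grind
    · refine Or.inr ⟨{f₁, f}, Or.inr ⟨f, hf, hn, rfl⟩, ?_⟩
      have h1 := (addable_subset hf₁).2
      have h2 := (addable_subset hf).2
      have hne : f ≠ f₁ := by rintro rfl; exact hn h₁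
      have : ¬ (({f₁, f} : Set α) ∩ B).Nonempty := by
        rintro ⟨x, rfl | rfl, hx⟩
        exacts [h1 hx, h2 hx]
      have e1 : ({f₁, f} : Set α) \ {f₁} = {f} := by
        ext x
        simp only [mem_sdiff, mem_insert_iff, mem_singleton_iff]
        grind
      simp only [h, if_neg this, e1, image_singleton]
      rw [insert_union, singleton_union]
  have hfin := nearPairs_finite (e₁ := e₁) hf₁ hB
  refine (ncard_le_ncard hsub ((hfin.image _).insert _)).trans ((ncard_insert_le _ _).trans ?_)
  exact Nat.add_le_add_right (ncard_image_le hfin) _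

theorem exists_ne_ne_of_three {e₁ e₂ e₃ : α} (h12 : e₁ ≠ e₂) (h13 : e₁ ≠ e₃) (h23 : e₂ ≠ e₃)
    (a b : α) : ∃ e, (e = e₁ ∨ e = e₂ ∨ e = e₃) ∧ e ≠ a ∧ e ≠ b := by
  by_contra hcon
  have k1 : e₁ = a ∨ e₁ = b := by by_contra h; exact hcon ⟨e₁, by simp, by tauto⟩
  have k2 : e₂ = a ∨ e₂ = b := by by_contra h; exact hcon ⟨e₂, by simp, by tauto⟩
  have k3 : e₃ = a ∨ e₃ = b := by by_contra h; exact hcon ⟨e₃, by simp, by tauto⟩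
  grind

/-- If the sets `P e` share a common subset of size `r - 2` and there are at least three of them,
then `N` has more bases than `M`. -/
theorem Shadow.numBases_lt [N.Finite] [Nonempty β] {e₁ e₂ e₃ f₁ : α} {d : α → α}
    (hS : Shadow M N B ({X | M.IsBase X} \ nearBases M B e₁ f₁ d) P θ Φ)
    (hB : M.IsBase B) (hr : rk N N.E = rk M M.E)
    (he₁ : e₁ ∈ removable M B) (hf₁ : f₁ ∈ addable M B)
    (h₁ : M.IsBase (insert f₁ (B \ {e₁})))
    (hd : ∀ f ∈ addable M B, d f ∈ B ∧ M.IsBase (insert f (B \ {d f})))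
    (he₂ : e₂ ∈ removable M B) (he₃ : e₃ ∈ removable M B) (h12 : e₁ ≠ e₂) (h13 : e₁ ≠ e₃)
    (h23 : e₂ ≠ e₃) (hsub : ∀ e ∈ removable M B, P e₁ ∩ P e₂ ⊆ P e) :
    numBases M < numBases N := by
  classical
  set D := P e₁ ∩ P e₂ with hDdef
  have hBf : B.Finite := finite_of_subset_ground hB.subset_ground
  have cD : D.ncard + 2 = rk N N.E := hS.ncard_inter _ he₁ _ he₂ h12
  have hPf : ∀ e ∈ removable M B, (P e).Finite := fun e he =>
    finite_of_subset_ground (hS.subset_ground e he)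
  have hDf : D.Finite := (hPf _ he₁).inter_of_left _
  have hx : ∀ e, ∃ b, e ∈ removable M B → b ∉ D ∧ P e = insert b D := by
    intro e
    by_cases he : e ∈ removable M B
    · have k1 := ncard_sdiff_add_ncard_of_subset (hsub e he) (hPf e he)
      have k2 := hS.ncard_add_one e he
      obtain ⟨b, hb⟩ := ncard_eq_one.1 (show (P e \ D).ncard = 1 by omega)
      refine ⟨b, fun _ => ⟨(hb ▸ mem_singleton b : b ∈ P e \ D).2, ?_⟩⟩
      rw [← singleton_union, ← hb, sdiff_union_of_subset (hsub e he)]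
    · exact ⟨Classical.arbitrary β, fun h => absurd h he⟩
  choose x hx using hx
  have xD : ∀ e ∈ removable M B, x e ∉ D := fun e he => (hx e he).1
  have xP : ∀ e ∈ removable M B, P e = insert (x e) D := fun e he => (hx e he).2
  have θD : ∀ f ∈ addable M B, θ f ∉ D := fun f hf h => hS.notMem _ he₁ f hf h.1
  let χ : α → β := fun y => if y ∈ B then x y else θ y
  have χV : ∀ e ∈ removable M B, χ e = x e := fun e he => by simp [χ, removable_subset he]
  have χW : ∀ f ∈ addable M B, χ f = θ f := fun f hf => by simp [χ, (addable_subset hf).2]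
  have hdVW : Disjoint (removable M B) (addable M B) :=
    disjoint_left.2 fun x h1 h2 => (addable_subset h2).2 (removable_subset h1)
  have xinj : InjOn x (removable M B) := by
    intro e he e' he' heq
    by_contra hcon
    have k1 := hS.ncard_inter e he e' he' hcon
    have k2 := hS.ncard_add_one e he
    rw [xP e' he', ← heq, ← xP e he, inter_self] at k1
    omega
  have χinj : InjOn χ (removable M B ∪ addable M B) := by
    rw [injOn_union hdVW]
    refine ⟨xinj.congr fun e he => (χV e he).symm, hS.injOn.congr fun f hf => (χW f hf).symm, ?_⟩
    intro e he f hf heq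
    rw [χV e he, χW f hf] at heq
    exact hS.notMem e he f hf (by rw [xP e he, heq]; exact mem_insert _ _)
  have χD : ∀ y ∈ removable M B ∪ addable M B, χ y ∉ D := by
    rintro y (hy | hy)
    · rw [χV y hy]; exact xD y hy
    · rw [χW y hy]; exact θD y hy
  -- Each of these pairs, added to the core `D`, gives a base of `N`. The pair `{e₁, e₂}` makes up
  -- for `B`, and `{e₁, e₃}` is the surplus that contradicts the count of bases.
  let 𝒬 : Set (Set α) := insert {e₁, e₂} (insert {e₁, e₃} (nearPairs M B e₁ f₁))
  have hP0f := nearPairs_finite (e₁ := e₁) hf₁ hB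
  have h𝒬f : 𝒬.Finite := (hP0f.insert _).insert _
  have hnotnear : ∀ p, p ⊆ B → p ∉ nearPairs M B e₁ f₁ := by
    rintro p hp (⟨e, he, f, hf, rfl, -⟩ | ⟨f, hf, -, rfl⟩)
    · exact (addable_subset hf).2 (hp (by simp))
    · exact (addable_subset hf).2 (hp (by simp))
  have m1 := removable_subset he₁
  have m2 := removable_subset he₂
  have m3 := removable_subset he₃
  have c𝒬 : 𝒬.ncard = (nearPairs M B e₁ f₁).ncard + 2 := by
    rw [ncard_insert_of_notMem _ (hP0f.insert _),
      ncard_insert_of_notMem (hnotnear _ (pair_subset m1 m3)) hP0f]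
    rintro (h | h)
    · have : e₂ ∈ ({e₁, e₃} : Set α) := by rw [← h]; simp
      rcases this with h | h
      exacts [h12 h.symm, h23 h]
    · exact hnotnear _ (pair_subset m1 m2) h
  have hsub𝒬 : ∀ p ∈ 𝒬, p ⊆ removable M B ∪ addable M B := by
    rintro p (rfl | rfl | ⟨e, he, f, hf, rfl, -⟩ | ⟨f, hf, -, rfl⟩)
    · exact pair_subset (Or.inl he₁) (Or.inl he₂)
    · exact pair_subset (Or.inl he₁) (Or.inl he₃)
    · exact pair_subset (Or.inl he) (Or.inr hf)
    · exact pair_subset (Or.inr hf₁) (Or.inr hf)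
  have hdouble : ∀ e ∈ removable M B, ∀ e' ∈ removable M B, e ≠ e' →
      N.IsBase (χ '' {e, e'} ∪ D) := by
    intro e he e' he' hne
    have := hS.isBase_union e he e' he' hne
    rw [xP e he, xP e' he'] at this
    rw [image_pair, χV e he, χV e' he', insert_union, singleton_union]
    rwa [insert_union, union_insert, union_self] at this
  have hbase𝒬 : ∀ p ∈ 𝒬, N.IsBase (χ '' p ∪ D) := by
    rintro p (rfl | rfl | ⟨e, he, f, hf, rfl, hb⟩ | ⟨f, hf, hn, rfl⟩)
    · exact hdouble _ he₁ _ he₂ h12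
    · exact hdouble _ he₁ _ he₃ h13
    · have := (hS.isBase_iff e he f hf).2 hb
      rw [xP e he] at this
      rwa [image_pair, χV e he, χW f hf, pair_comm, insert_union, singleton_union]
    · have hdV : d f ∈ removable M B :=
        mem_removable_of_isBase (hd f hf).1 (addable_subset hf) (hd f hf).2
      have b1 := (hS.isBase_iff e₁ he₁ f₁ hf₁).2 h₁
      have b2 := (hS.isBase_iff e₁ he₁ f hf).not.2 hn
      have b3 := (hS.isBase_iff _ hdV f hf).2 (hd f hf).2
      rw [xP _ he₁] at b1 b2
      rw [xP _ hdV] at b3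
      rw [image_pair, χW f hf, χW f₁ hf₁, insert_union, singleton_union]
      refine isBase_insert_insert b1 b2 b3 (xD _ hdV) ?_
      intro h
      exact hS.notMem _ hdV f hf (by rw [xP _ hdV, h]; exact mem_insert _ _)
  have hinj𝒬 : InjOn (fun p => χ '' p ∪ D) 𝒬 := by
    intro p hp q hq hpq
    have hdis : ∀ p ∈ 𝒬, Disjoint (χ '' p) D := by
      intro p hp
      rw [disjoint_left]
      rintro _ ⟨y, hy, rfl⟩
      exact χD y (hsub𝒬 p hp hy)
    have key : ∀ p ∈ 𝒬, (χ '' p ∪ D) \ D = χ '' p := fun p hp => by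
      rw [union_sdiff_right, (hdis p hp).sdiff_eq_left]
    have : χ '' p = χ '' q := by
      rw [← key p hp, ← key q hq]
      exact congrArg (· \ D) hpq
    exact (χinj.image_eq_image_iff (hsub𝒬 p hp) (hsub𝒬 q hq)).1 this
  set R := {X | M.IsBase X} \ nearBases M B e₁ f₁ d with hRdef
  have hRf : R.Finite := (setOf_isBase_finite M).sdiff
  -- A far base misses two elements `a`, `b` of `B`. With `e` different from both, `X` meets `B \
  -- {e}` in at most `r - 3` elements, so `Φ X` cannot contain the `r - 2` elements of `D`, all
  -- lying in `P e`.
  have hRD : ∀ X ∈ R, ¬ D ⊆ Φ X := by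
    intro X hX hDX
    have hBX := sdiff_subset_removable hB hX.1
    have h2 := two_le_ncard_sdiff hB hX.1 hX.2
    obtain ⟨a, b, ha, hb, hab⟩ := (one_lt_ncard_iff hBf.sdiff).1 h2
    obtain ⟨e, he, hea, heb⟩ := exists_ne_ne_of_three h12 h13 h23 a b
    have heV : e ∈ removable M B := by rcases he with rfl | rfl | rfl <;> assumption
    have k1 := hS.ncard_map_inter X hX e heV
    have k2 : D.ncard ≤ (Φ X ∩ P e).ncard :=
      ncard_le_ncard (subset_inter hDX (hsub e heV)) ((hPf e heV).inter_of_right _)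
    have k3 : X ∩ (B \ {e}) ⊆ ((B \ {e}) \ {a}) \ {b} := by
      rintro y ⟨hyX, hyB⟩
      exact ⟨⟨hyB, by rintro rfl; exact ha.2 hyX⟩, by rintro rfl; exact hb.2 hyX⟩
    have k4 := ncard_le_ncard k3 (hBf.sdiff.sdiff.sdiff)
    have k5 := ncard_sdiff_singleton_add_one (removable_subset heV) hBf
    have k6 := ncard_sdiff_singleton_add_one (s := B \ {e}) (a := a) ⟨ha.1, hea.symm⟩ hBf.sdiff
    have k7 := ncard_sdiff_singleton_add_one (s := (B \ {e}) \ {a}) (a := b)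
      ⟨⟨hb.1, heb.symm⟩, hab.symm⟩ hBf.sdiff.sdiff
    have k8 := isBase_ncard hB
    omega
  have hN : R.ncard + 𝒬.ncard ≤ numBases N := by
    rw [← hS.injOn_map.ncard_image, ← hinj𝒬.ncard_image,
      ← ncard_union_eq _ (hRf.image _) (h𝒬f.image _)]
    · refine ncard_le_ncard ?_ (setOf_isBase_finite N)
      rintro _ (⟨X, hX, rfl⟩ | ⟨p, hp, rfl⟩)
      · exact hS.isBase_map X hX
      · exact hbase𝒬 p hp
    · rw [disjoint_left]
      rintro _ ⟨X, hX, rfl⟩ ⟨p, hp, hpX⟩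
      refine hRD X hX ?_
      rw [← hpX]
      exact subset_union_right
  have hM : R.ncard + (nearBases M B e₁ f₁ d).ncard = numBases M :=
    ncard_sdiff_add_ncard_of_subset (nearBases_subset hB m1 h₁ hd) (setOf_isBase_finite M)
  have := ncard_nearBases_le (d := d) hB hf₁ h₁
  omega

end

/-! ### Reconstruction from the genus given by the number of bases -/

section

variable {α : Type*} {β : Type*} {M : Matroid α} {N : Matroid β} [M.Finite] [N.Finite]
  {B : Set α} {g : ℕ}

/-- `B` is the only base of `M`, so any bijection taking `B` to a base of `N` works. -/
theorem iso_of_removable_eq_empty [Nonempty β] (hg : 0 < g) (h : whitney g N = whitney g M)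
    (hB : M.IsBase B) (hV : removable M B = ∅) : Iso M N := by
  obtain ⟨B', hB'⟩ := N.exists_isBase
  obtain ⟨ψ, hψ, -, hψK⟩ := exists_bijOn_extending (E := M.E) (E' := N.E)
    (U := ∅) (K := B) (K' := B') (θ := fun _ => Classical.arbitrary β)
    M.ground_finite N.ground_finite (empty_subset _) hB.subset_ground (by simp)
    (by simp) (by simp) hB'.subset_ground (by simp)
    (by rw [isBase_ncard hB, isBase_ncard hB', rk_ground_eq_of_whitney_eq hg h])
    (ncard_ground_eq_of_whitney_eq hg h).symm
  refine iso_of_bijOn hψ (fun X hX => ?_) (numBases_le_of_whitney_eq hg h)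
  have : B = X := hB.eq_of_subset_isBase hX
    (sdiff_eq_empty.1 (subset_empty_iff.1 (hV ▸ sdiff_subset_removable hB hX)))
  rwa [← this, hψK]

/-- The bases are `B` with `e₁` replaced by a member of its parallel class `U`. There are as many of
them as elements of `U`, so the singletons of `U` fit into a tuple, and ranks of pairs show that
their images are parallel in `N`. -/
theorem iso_of_removable_eq_singleton [Nonempty β] {e₁ : α} (hg : numBases M ≤ g)
    (h : whitney g N = whitney g M) (hB : M.IsBase B) (hV : removable M B = {e₁}) :
    Iso M N := by
  have hg0 : 0 < g := (numBases_pos M).trans_le hg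
  have hr := rk_ground_eq_of_whitney_eq hg0 h
  have he₁ : e₁ ∈ B := removable_subset (hV ▸ mem_singleton e₁)
  have hBf : B.Finite := finite_of_subset_ground hB.subset_ground
  have hex : ∀ f ∈ addable M B, M.IsBase (insert f (B \ {e₁})) := by
    rintro f ⟨hf, e, he, hb⟩
    have := mem_removable_of_isBase he hf hb
    rw [hV, mem_singleton_iff] at this
    rwa [← this]
  set U : Set α := insert e₁ (addable M B) with hUdef
  have hUE : U ⊆ M.E :=
    insert_subset (hB.subset_ground he₁) (addable_subset.trans sdiff_subset)
  have hUf : U.Finite := finite_of_subset_ground hUE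
  have hUK : Disjoint U (B \ {e₁}) := by
    rw [disjoint_left]
    rintro x (rfl | hx) hxB
    · exact hxB.2 rfl
    · exact (addable_subset hx).2 hxB.1
  have hUbase : ∀ x ∈ U, M.IsBase (insert x (B \ {e₁})) := by
    rintro x (rfl | hx)
    · rwa [insert_sdiff_singleton, insert_eq_of_mem he₁]
    · exact hex x hx
  have hUcard : U.ncard ≤ numBases M := by
    refine ncard_le_ncard_of_injOn (fun x => insert x (B \ {e₁})) hUbase ?_ (setOf_isBase_finite M)
    intro x hx y hy hxy
    have : x ∈ insert y (B \ {e₁}) := by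
      rw [← show insert x (B \ {e₁}) = insert y (B \ {e₁}) from hxy]
      exact mem_insert _ _
    rcases this with h | h
    · exact h
    · exact absurd h (disjoint_left.1 hUK hx)
  obtain ⟨Φ, hΦ, hdata⟩ := exists_map_of_whitney_eq (𝒜 := (fun x => {x}) '' U) hg0 h
    (hUf.image _) ((ncard_image_le hUf).trans (hUcard.trans hg))
    (by rintro _ ⟨x, hx, rfl⟩; exact singleton_subset_iff.2 (hUE hx))
  have mU : ∀ x ∈ U, ({x} : Set α) ∈ (fun x => ({x} : Set α)) '' U := fun x hx => ⟨x, hx, rfl⟩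
  have hsing : ∀ x, ∃ b, x ∈ U → Φ {x} = {b} := by
    intro x
    by_cases hx : x ∈ U
    · have := (hdata _ (mU x hx) _ (mU x hx)).1
      rw [inter_self, inter_self, ncard_singleton, ncard_eq_one] at this
      obtain ⟨b, hb⟩ := this
      exact ⟨b, fun _ => hb⟩
    · exact ⟨Classical.arbitrary β, fun h => absurd h hx⟩
  choose θ hθ using hsing
  have heU : e₁ ∈ U := mem_insert _ _
  have θE : ∀ x ∈ U, θ x ∈ N.E := fun x hx => by
    have := hΦ _ (mU x hx)
    rwa [hθ x hx, singleton_subset_iff] at this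
  have θinj : InjOn θ U := by
    intro x hx y hy hxy
    by_contra hne
    have := (hdata _ (mU x hx) _ (mU y hy)).1
    rw [hθ x hx, hθ y hy, hxy, inter_self, ncard_singleton,
      singleton_inter_eq_empty.2 (by simpa using hne), ncard_empty] at this
    exact one_ne_zero this
  have hindep : ∀ x ∈ U, ∀ y ∈ U, (N.Indep {θ x, θ y} ↔ M.Indep {x, y}) := by
    intro x hx y hy
    obtain ⟨-, h2, -, h4⟩ := hdata _ (mU x hx) _ (mU y hy)
    rw [hθ x hx, hθ y hy, singleton_union, singleton_union] at h2 h4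
    rw [indep_iff_rk (pair_subset (θE x hx) (θE y hy)),
      indep_iff_rk (pair_subset (hUE hx) (hUE hy)), h2, h4]
  have hsingle : ∀ x ∈ U, N.Indep {θ x} := by
    intro x hx
    have := (hindep x hx x hx).2 (by
      rw [pair_eq_singleton]
      exact (hUbase x hx).indep.subset (singleton_subset_iff.2 (mem_insert _ _)))
    rwa [pair_eq_singleton] at this
  -- A base containing `e₁` and `f` would contain all of `B`, since only `e₁` is removable.
  have hpar : ∀ f ∈ addable M B, ¬ N.Indep {θ e₁, θ f} := by
    intro f hf
    rw [hindep e₁ heU f (Or.inr hf)]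
    intro hI
    obtain ⟨X, hX, hsub⟩ := hI.exists_isBase_superset
    have h1 := sdiff_subset_removable hB hX
    rw [hV] at h1
    have h2 : B ⊆ X := by
      intro y hy
      by_contra hyX
      have : y = e₁ := h1 ⟨hy, hyX⟩
      exact hyX (this ▸ hsub (by simp))
    have h3 := hB.eq_of_subset_isBase hX h2
    exact (addable_subset hf).2 (h3 ▸ hsub (by simp))
  obtain ⟨B', hB', hsubB'⟩ := (hsingle e₁ heU).exists_isBase_superset
  have heB' : θ e₁ ∈ B' := hsubB' rfl
  have hθB' : ∀ f ∈ addable M B, θ f ∉ B' := fun f hf hmem =>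
    hpar f hf (hB'.indep.subset (pair_subset heB' hmem))
  have hexN : ∀ f ∈ addable M B, N.IsBase (insert (θ f) (B' \ {θ e₁})) := by
    intro f hf
    obtain ⟨e, he, hb⟩ := exists_exchange_of_indep_singleton hB' (hsingle f (Or.inr hf))
      (hθB' f hf)
    by_cases hee : e = θ e₁
    · rwa [← hee]
    · exact absurd (hb.indep.subset (pair_subset (Or.inr ⟨heB', fun h => hee h.symm⟩)
        (mem_insert _ _))) (hpar f hf)
  obtain ⟨ψ, hψ, hψU, hψK⟩ := exists_bijOn_extending (E := M.E) (E' := N.E)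
    (U := U) (K := B \ {e₁}) (K' := B' \ {θ e₁}) (θ := θ)
    M.ground_finite N.ground_finite hUE (sdiff_subset.trans hB.subset_ground) hUK θinj
    (by rintro _ ⟨x, hx, rfl⟩; exact θE x hx) (sdiff_subset.trans hB'.subset_ground)
    (by
      rw [disjoint_left]
      rintro _ ⟨x, rfl | hx, rfl⟩ hxB
      · exact hxB.2 rfl
      · exact hθB' x hx hxB.1)
    (by
      have k1 := ncard_sdiff_singleton_add_one he₁ hBf
      have k2 := ncard_sdiff_singleton_add_one heB' (finite_of_subset_ground hB'.subset_ground)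
      have k3 := isBase_ncard hB
      have k4 := isBase_ncard hB'
      omega)
    (ncard_ground_eq_of_whitney_eq hg0 h).symm
  refine iso_of_bijOn hψ (fun X hX => ?_) (numBases_le_of_whitney_eq hg0 h)
  obtain ⟨x, hxU, rfl⟩ : ∃ x ∈ U, X = insert x (B \ {e₁}) := by
    have h1 := sdiff_subset_removable hB hX
    rw [hV] at h1
    rcases subset_singleton_iff_eq.1 h1 with h0 | h0
    · refine ⟨e₁, heU, ?_⟩
      rw [insert_sdiff_singleton, insert_eq_of_mem he₁]
      exact (hB.eq_of_subset_isBase hX (sdiff_eq_empty.1 h0)).symm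
    · obtain ⟨f, hf, hXf⟩ := hB.eq_exchange_of_sdiff_eq_singleton hX h0
      refine ⟨f, Or.inr (sdiff_subset_addable hB hX hf), ?_⟩
      rw [hXf, insert_sdiff_of_notMem]
      rintro rfl
      exact hf.2 he₁
  rw [image_insert_eq, hψK, hψU hxU]
  rcases hxU with rfl | hx
  · rwa [insert_sdiff_singleton, insert_eq_of_mem heB']
  · exact hexN x hx

theorem iso_of_whitney_eq (hg : numBases M ≤ g) (h : whitney g N = whitney g M) : Iso M N := by
  have hg0 : 0 < g := (numBases_pos M).trans_le hg
  have hE := ncard_ground_eq_of_whitney_eq hg0 h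
  have hle := numBases_le_of_whitney_eq hg0 h
  by_cases hNE : N.E = ∅
  · rw [hNE, ncard_empty, eq_comm, ncard_eq_zero M.ground_finite] at hE
    exact iso_of_ground_eq_empty hE hNE
  have : Nonempty β := (nonempty_iff_ne_empty.2 hNE).nonempty
  obtain ⟨B, hB⟩ := M.exists_isBase
  rcases (removable M B).subsingleton_or_nontrivial with hss | ⟨e₁, he₁, e₂, he₂, hne⟩
  · rcases hss.eq_empty_or_singleton with hV | ⟨e₁, hV⟩
    · exact iso_of_removable_eq_empty hg0 h hB hV
    · exact iso_of_removable_eq_singleton hg h hB hV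
  obtain ⟨f₁, hf₁E, h₁⟩ := he₁.2
  have hf₁ : f₁ ∈ addable M B := mem_addable_of_isBase (removable_subset he₁) hf₁E h₁
  have hd : ∀ f, ∃ e, f ∈ addable M B → e ∈ B ∧ M.IsBase (insert f (B \ {e})) := by
    intro f
    by_cases hf : f ∈ addable M B
    · obtain ⟨e, he, hb⟩ := hf.2
      exact ⟨e, fun _ => ⟨he, hb⟩⟩
    · exact ⟨f, fun h => absurd h hf⟩
  choose d hd using hd
  have hcard : (removable M B ∪ addable M B).ncard +
      ({X | M.IsBase X} \ nearBases M B e₁ f₁ d).ncard ≤ g := by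
    have k1 := ncard_le_ncard_nearBases (d := d) hB (removable_subset he₁) hf₁E h₁ hd
    have k2 : _ = numBases M := ncard_sdiff_add_ncard_of_subset
      (nearBases_subset hB (removable_subset he₁) h₁ hd) (setOf_isBase_finite M)
    omega
  obtain ⟨P, θ, Φ, hS⟩ := exists_shadow hg0 h hB (fun X hX => hX.1) hcard
  have hr := rk_ground_eq_of_whitney_eq hg0 h
  rcases hS.subset_union_or_inter_subset he₁ he₂ hne with hsub | ⟨e₃, he₃, h31, h32, hsub⟩
  · exact hS.iso_of_subset hB hr hE hle he₁ hf₁ h₁ hd he₂ hne hsub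
  · have := hS.numBases_lt hB hr he₁ hf₁ h₁ hd he₂ he₃ hne h31.symm h32.symm hsub
    omega

theorem whitney_congr (h : tutte g N = tutte g M) : whitney g N = whitney g M := by
  rw [whitney, whitney, h]

end

/-! ### Sums over tuples and invariance under isomorphism -/

/-- The sum of a function over all `g`-tuples of subsets of a finite set. -/
noncomputable def tupleSum {α R : Type*} [AddCommMonoid R] (g : ℕ) {E : Set α} (hE : E.Finite)
    (F : (Fin g → Set α) → R) : R :=
  ∑ A ∈ Fintype.piFinset (fun _ : Fin g => hE.toFinset.powerset), F (fun i => (A i : Set α))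

theorem tutte_eq_tupleSum {α : Type*} (g : ℕ) (M : Matroid α) [M.Finite] :
    tutte g M = tupleSum g M.ground_finite (tutteTerm M) := rfl

section TupleSum

variable {α β R : Type*} [AddCommMonoid R] {g : ℕ} {E : Set α} {E' : Set β} (hE : E.Finite)
  (hE' : E'.Finite)

theorem tupleSum_congr {F G : (Fin g → Set α) → R}
    (h : ∀ A : Fin g → Set α, (∀ i, A i ⊆ E) → F A = G A) : tupleSum g hE F = tupleSum g hE G := by
  refine Finset.sum_congr rfl fun A hA => h _ fun i x hx => ?_
  simp only [Fintype.mem_piFinset, Finset.mem_powerset] at hA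
  simpa using hA i hx

/-- The bijection is between subsets rather than elements, which covers both matroid isomorphisms
and the flips of the parity construction. -/
theorem tupleSum_map {F : (Fin g → Set α) → R} {G : (Fin g → Set β) → R}
    {T : Set α → Set β} {T' : Set β → Set α} (hT : ∀ X ⊆ E, T X ⊆ E') (hT' : ∀ Y ⊆ E', T' Y ⊆ E)
    (hl : ∀ X ⊆ E, T' (T X) = X) (hr : ∀ Y ⊆ E', T (T' Y) = Y)
    (h : ∀ A : Fin g → Set α, (∀ i, A i ⊆ E) → F A = G (fun i => T (A i))) :
    tupleSum g hE F = tupleSum g hE' G := by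
  classical
  have mem1 : ∀ {A : Fin g → Finset α},
      A ∈ Fintype.piFinset (fun _ : Fin g => hE.toFinset.powerset) ↔ ∀ i, (A i : Set α) ⊆ E := by
    intro A
    simp [Finset.mem_powerset, ← Finset.coe_subset]
  have mem2 : ∀ {A : Fin g → Finset β},
      A ∈ Fintype.piFinset (fun _ : Fin g => hE'.toFinset.powerset) ↔ ∀ i, (A i : Set β) ⊆ E' := by
    intro A
    simp [Finset.mem_powerset, ← Finset.coe_subset]
  let t : Finset α → Finset β := fun X =>
    if h : (T X).Finite then h.toFinset else ∅
  let t' : Finset β → Finset α := fun X =>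
    if h : (T' X).Finite then h.toFinset else ∅
  have ht : ∀ X : Finset α, (X : Set α) ⊆ E → (t X : Set β) = T X := fun X hX => by
    simp [t, hE'.subset (hT X hX)]
  have ht' : ∀ X : Finset β, (X : Set β) ⊆ E' → (t' X : Set α) = T' X := fun X hX => by
    simp [t', hE.subset (hT' X hX)]
  refine Finset.sum_bij' (fun A _ i => t (A i)) (fun A _ i => t' (A i)) ?_ ?_ ?_ ?_ ?_
  · intro A hA
    rw [mem1] at hA
    rw [mem2]
    exact fun i => by rw [ht _ (hA i)]; exact hT _ (hA i)
  · intro A hA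
    rw [mem2] at hA
    rw [mem1]
    exact fun i => by rw [ht' _ (hA i)]; exact hT' _ (hA i)
  · intro A hA
    rw [mem1] at hA
    funext i
    apply Finset.coe_injective
    rw [ht' _ (by rw [ht _ (hA i)]; exact hT _ (hA i)), ht _ (hA i), hl _ (hA i)]
  · intro A hA
    rw [mem2] at hA
    funext i
    apply Finset.coe_injective
    rw [ht _ (by rw [ht' _ (hA i)]; exact hT' _ (hA i)), ht' _ (hA i), hr _ (hA i)]
  · intro A hA
    rw [mem1] at hA
    rw [h _ hA]
    congr 1
    funext i
    rw [ht _ (hA i)]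

end TupleSum

theorem setAt_map {α β : Type*} {g : ℕ} {A : Fin g → Set α} {T : Set α → Set β}
    (hi : ∀ X Y, T (X ∩ Y) = T X ∩ T Y) (hu : ∀ X Y, T (X ∪ Y) = T X ∪ T Y) :
    ∀ l, setAt (fun i => T (A i)) l = T (setAt A l)
  | Sum.inl _ => rfl
  | Sum.inr (Sum.inl _) => (hi _ _).symm
  | Sum.inr (Sum.inr _) => (hu _ _).symm

section Iso

variable {α : Type*} {β : Type*} {M : Matroid α} {N : Matroid β}

/-- The map on subsets induced by a bijection between the ground sets. -/
def mapSet (φ : M.E ≃ N.E) (X : Set α) : Set β := (↑) '' (φ '' ((↑) ⁻¹' X))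

theorem mapSet_subset (φ : M.E ≃ N.E) (X : Set α) : mapSet φ X ⊆ N.E :=
  Subtype.coe_image_subset _ _

theorem mapSet_symm_mapSet (φ : M.E ≃ N.E) {X : Set α} (hX : X ⊆ M.E) :
    mapSet φ.symm (mapSet φ X) = X := by
  unfold mapSet
  rw [preimage_image_eq _ Subtype.val_injective, φ.symm_image_image, Subtype.image_preimage_coe,
    inter_eq_right.2 hX]

theorem mapSet_inter (φ : M.E ≃ N.E) (X Y : Set α) :
    mapSet φ (X ∩ Y) = mapSet φ X ∩ mapSet φ Y := by
  unfold mapSet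
  rw [preimage_inter, image_inter φ.injective, image_inter Subtype.val_injective]

theorem mapSet_union (φ : M.E ≃ N.E) (X Y : Set α) :
    mapSet φ (X ∪ Y) = mapSet φ X ∪ mapSet φ Y := by
  unfold mapSet
  rw [preimage_union, image_union, image_union]

theorem mapSet_mono (φ : M.E ≃ N.E) {X Y : Set α} (h : X ⊆ Y) : mapSet φ X ⊆ mapSet φ Y :=
  image_mono (image_mono (preimage_mono h))

theorem encard_mapSet (φ : M.E ≃ N.E) {X : Set α} (hX : X ⊆ M.E) :
    (mapSet φ X).encard = X.encard := by
  unfold mapSet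
  rw [Subtype.val_injective.encard_image, φ.injective.encard_image,
    ← Subtype.val_injective.encard_image, Subtype.image_preimage_coe, inter_eq_right.2 hX]

theorem eRk_le_eRk_mapSet {φ : M.E ≃ N.E}
    (hφ : ∀ I, M.Indep I → N.Indep (mapSet φ I)) (X : Set α) :
    M.eRk X ≤ N.eRk (mapSet φ X) := by
  obtain ⟨I, hI⟩ := M.exists_isBasis' X
  rw [hI.eRk_eq_encard, ← encard_mapSet φ hI.indep.subset_ground]
  exact (hφ I hI.indep).encard_le_eRk_of_subset (mapSet_mono φ hI.subset)

theorem indep_mapSet_iff {φ : M.E ≃ N.E}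
    (hφ : ∀ I : Set M.E, M.Indep ((↑) '' I : Set α) ↔ N.Indep ((↑) '' (φ '' I) : Set β))
    {I : Set α} (hI : I ⊆ M.E) : M.Indep I ↔ N.Indep (mapSet φ I) := by
  have := hφ ((↑) ⁻¹' I)
  rwa [Subtype.image_preimage_coe, inter_eq_right.2 hI] at this

theorem tutte_eq_of_iso [M.Finite] [N.Finite] (g : ℕ) (h : Iso M N) : tutte g M = tutte g N := by
  obtain ⟨φ, hφ⟩ := h
  have h1 : ∀ I, M.Indep I → N.Indep (mapSet φ I) := fun I hI =>
    (indep_mapSet_iff hφ hI.subset_ground).1 hI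
  have h2 : ∀ I, N.Indep I → M.Indep (mapSet φ.symm I) := fun I hI => by
    rw [indep_mapSet_iff hφ (mapSet_subset _ _)]
    have := mapSet_symm_mapSet φ.symm hI.subset_ground
    rw [Equiv.symm_symm] at this
    rwa [this]
  have hrk : ∀ X ⊆ M.E, rk N (mapSet φ X) = rk M X := by
    intro X hX
    unfold rk
    congr 1
    refine le_antisymm ?_ (eRk_le_eRk_mapSet h1 X)
    conv_rhs => rw [← mapSet_symm_mapSet φ hX]
    exact eRk_le_eRk_mapSet h2 _
  have hE : mapSet φ M.E = N.E := by
    refine (mapSet_subset _ _).antisymm ?_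
    have := mapSet_symm_mapSet φ.symm (subset_refl N.E)
    rw [Equiv.symm_symm] at this
    conv_lhs => rw [← this]
    exact mapSet_mono φ (mapSet_subset _ _)
  refine tupleSum_map (T := mapSet φ) (T' := mapSet φ.symm) M.ground_finite N.ground_finite
    (fun X _ => mapSet_subset φ X)
    (fun Y _ => mapSet_subset _ _) (fun X hX => mapSet_symm_mapSet φ hX)
    (fun Y hY => by simpa using mapSet_symm_mapSet φ.symm hY) fun A hA => ?_
  unfold tutteTerm
  refine Finset.prod_congr rfl fun l _ => ?_
  rw [setAt_map (mapSet_inter φ) (mapSet_union φ), hrk _ (setAt_subset hA l), ← hE,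
    hrk _ subset_rfl, ncard, ncard, encard_mapSet φ (setAt_subset hA l)]

end Iso

/-! ### Sparse paving matroids -/

section SparsePaving

variable {α : Type*} {E : Set α} {r : ℕ} {H : Set (Set α)}

/-- The conditions under which the `r`-subsets of `E` outside `H` are the bases of a matroid. -/
structure IsSparse (E : Set α) (r : ℕ) (H : Set (Set α)) : Prop where
  finite : E.Finite
  pos : 0 < r
  lt_ncard : r < E.ncard
  subset : ∀ X ∈ H, X ⊆ E
  ncard_eq : ∀ X ∈ H, X.ncard = r
  two_le : ∀ X ∈ H, ∀ Y ∈ H, X ≠ Y → 2 ≤ (X \ Y).ncard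

/-- The sparse paving matroid with circuit-hyperplanes `H`. -/
noncomputable def sparsePaving (h : IsSparse E r H) : Matroid α :=
  (IndepMatroid.ofFinite h.finite (fun I => I ⊆ E ∧ I.ncard ≤ r ∧ I ∉ H)
    ⟨empty_subset _, by simp, fun h0 => by have := h.ncard_eq _ h0; have := h.pos; simp_all⟩
    (by
      rintro I J ⟨hJ, hc, hn⟩ hIJ
      have hJf := h.finite.subset hJ
      refine ⟨hIJ.trans hJ, (ncard_le_ncard hIJ hJf).trans hc, fun hI => ?_⟩
      have : I = J := eq_of_subset_of_ncard_le hIJ (by rw [h.ncard_eq I hI]; exact hc) hJf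
      exact hn (this ▸ hI))
    (by
      rintro I J ⟨hI, hIc, hIn⟩ ⟨hJ, hJc, hJn⟩ hlt
      have hIf := h.finite.subset hI
      have hJf := h.finite.subset hJ
      obtain ⟨e, heJ, heI⟩ := exists_mem_notMem_of_ncard_lt_ncard hlt hIf
      have hc : ∀ e ∉ I, (insert e I).ncard = I.ncard + 1 := fun e he =>
        ncard_insert_of_notMem he hIf
      -- If `I + e` is a circuit-hyperplane, another element `f` of `J` serves: `I + e` and `I + f`
      -- differ by one exchange, so they cannot both belong to `H`.
      by_cases he : insert e I ∈ H
      · by_cases hsub : J ⊆ insert e I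
        · have : J = insert e I :=
            eq_of_subset_of_ncard_le hsub (by rw [hc e heI]; omega) (hIf.insert _)
          exact absurd (this ▸ he) hJn
        · obtain ⟨f, hfJ, hf⟩ := not_subset.1 hsub
          have hfI : f ∉ I := fun h => hf (Or.inr h)
          have hfe : f ≠ e := fun h => hf (Or.inl h)
          refine ⟨f, hfJ, hfI, insert_subset (hJ hfJ) hI, by rw [hc f hfI]; omega, fun hfH => ?_⟩
          have h2 := h.two_le _ he _ hfH (fun heq => hf (heq ▸ mem_insert f I))
          have h3 : insert e I \ insert f I ⊆ {e} := by
            rintro x ⟨rfl | hx, hx'⟩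
            · rfl
            · exact absurd (Or.inr hx) hx'
          have := ncard_le_ncard h3
          rw [ncard_singleton] at this
          omega
      · exact ⟨e, heJ, heI, insert_subset (hJ heJ) hI, by rw [hc e heI]; omega, he⟩)
    (fun _ hI => hI.1)).matroid

variable (h : IsSparse E r H)

theorem sparsePaving_ground : (sparsePaving h).E = E := rfl

theorem sparsePaving_indep {I : Set α} :
    (sparsePaving h).Indep I ↔ I ⊆ E ∧ I.ncard ≤ r ∧ I ∉ H := by
  simp [sparsePaving]

theorem sparsePaving_finite : (sparsePaving h).Finite := ⟨h.finite⟩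

theorem rk_eq_of_forall {M : Matroid α} [M.Finite] {X I : Set α} (hIX : I ⊆ X) (hI : M.Indep I)
    (hle : ∀ J ⊆ X, M.Indep J → J.ncard ≤ I.ncard) : rk M X = I.ncard := by
  apply le_antisymm
  · obtain ⟨J, hJ⟩ := M.exists_isBasis' X
    have h1 := hJ.eRk_eq_encard
    rw [← coe_rk, ← (finite_of_subset_ground hJ.indep.subset_ground).cast_ncard_eq] at h1
    have h2 : rk M X = J.ncard := by exact_mod_cast h1
    rw [h2]
    exact hle J hJ.subset hJ.indep
  · rw [← (indep_iff_rk hI.subset_ground).1 hI]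
    exact rk_mono hIX

theorem rk_sparsePaving_of_mem {X : Set α} (hX : X ∈ H) : rk (sparsePaving h) X = r - 1 := by
  have := sparsePaving_finite h
  have hXf := h.finite.subset (h.subset X hX)
  have hXc := h.ncard_eq X hX
  have hpos := h.pos
  obtain ⟨x, hx⟩ : X.Nonempty := nonempty_of_ncard_ne_zero (by omega)
  have hc := ncard_sdiff_singleton_add_one hx hXf
  have := rk_eq_of_forall (M := sparsePaving h) (X := X) (I := X \ {x}) sdiff_subset ?_ ?_
  · omega
  · rw [sparsePaving_indep]
    refine ⟨sdiff_subset.trans (h.subset X hX), by omega, fun hm => ?_⟩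
    have := h.ncard_eq _ hm
    omega
  · intro J hJX hJ
    rw [sparsePaving_indep] at hJ
    have hne : J ≠ X := by rintro rfl; exact hJ.2.2 hX
    have := ncard_lt_ncard (hJX.ssubset_of_ne hne) hXf
    omega

theorem rk_sparsePaving_of_notMem {X : Set α} (hXE : X ⊆ E) (hX : X ∉ H) :
    rk (sparsePaving h) X = min X.ncard r := by
  have := sparsePaving_finite h
  have hXf := h.finite.subset hXE
  have key : ∀ I ⊆ X, (sparsePaving h).Indep I → I.ncard = min X.ncard r →
      rk (sparsePaving h) X = min X.ncard r := by
    intro I hIX hI hc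
    rw [← hc]
    refine rk_eq_of_forall hIX hI fun J hJX hJ => ?_
    rw [hc]
    exact le_min (ncard_le_ncard hJX hXf) ((sparsePaving_indep h).1 hJ).2.1
  rcases le_or_gt X.ncard r with hle | hlt
  · exact key X subset_rfl ((sparsePaving_indep h).2 ⟨hXE, hle, hX⟩) (min_eq_left hle).symm
  · obtain ⟨Y, hYX, hYc⟩ := exists_subset_card_eq hlt.le
    have hYf := hXf.subset hYX
    -- If the chosen `r`-subset is a circuit-hyperplane, one exchange inside `X` leads to an `r`-set
    -- that is not.
    by_cases hY : Y ∈ H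
    · have hpos := h.pos
      obtain ⟨y, hy⟩ : Y.Nonempty := nonempty_of_ncard_ne_zero (by omega)
      obtain ⟨z, hzX, hzY⟩ := exists_mem_notMem_of_ncard_lt_ncard
        (by rwa [hYc] : Y.ncard < X.ncard) hYf
      have hzY' : z ∉ Y \ {y} := fun h => hzY h.1
      have hc := ncard_sdiff_singleton_add_one hy hYf
      have hc' := ncard_insert_of_notMem hzY' hYf.sdiff
      have hsub : insert z (Y \ {y}) ⊆ X := insert_subset hzX (sdiff_subset.trans hYX)
      refine key _ hsub ?_ (by omega)
      rw [sparsePaving_indep]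
      refine ⟨hsub.trans hXE, by omega, fun hm => ?_⟩
      have h2 := h.two_le _ hY _ hm (fun heq => hzY (heq ▸ mem_insert _ _))
      rw [sdiff_insert_sdiff hy hzY, ncard_singleton] at h2
      omega
    · exact key Y hYX ((sparsePaving_indep h).2 ⟨hYX.trans hXE, hYc.le, hY⟩) (by omega)

theorem rk_ground_sparsePaving : rk (sparsePaving h) (sparsePaving h).E = r := by
  have h1 := h.lt_ncard
  rw [sparsePaving_ground, rk_sparsePaving_of_notMem h subset_rfl]
  · omega
  · intro hm
    have := h.ncard_eq _ hm
    omega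

theorem mem_of_rk_eq {X : Set α} (hXE : X ⊆ E) (hc : X.ncard = r)
    (hr : rk (sparsePaving h) X = r - 1) : X ∈ H := by
  by_contra hX
  rw [rk_sparsePaving_of_notMem h hXE hX] at hr
  have := h.pos
  omega

open Classical in
/-- The factors of the expansion of a term of the Tutte polynomial of a sparse paving matroid:
`none` stands for the contribution of the uniform matroid, and `some i` for the correction
made by the circuit-hyperplane `H i`. -/
noncomputable def pavingFactor {ι : Type*} {g : ℕ} (r : ℕ) (H : ι → Set α) (l : Label g)
    (X : Set α) (o : Option ι) : MvPolynomial (Var g) ℤ :=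
  (MvPolynomial.X (Var.x l) - 1) ^ (r - min X.ncard r) *
    (MvPolynomial.X (Var.y l) - 1) ^ (X.ncard - min X.ncard r) *
    o.elim 1 fun i => if X = H i then
      (MvPolynomial.X (Var.x l) - 1) * (MvPolynomial.X (Var.y l) - 1) - 1 else 0

/-- Each factor is that of the uniform matroid plus a correction when the set is some `H i`. A
circuit-hyperplane has corank and nullity one, hence the correction `(x - 1)(y - 1) - 1`.
Multiplying out gives one summand per choice `c` of corrections. -/
theorem tutteTerm_sparsePaving {ι : Type*} [Fintype ι] {H : ι → Set α} (hH : Function.Injective H)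
    (h : IsSparse E r (range H)) {g : ℕ} {A : Fin g → Set α} (hA : ∀ i, A i ⊆ E) :
    tutteTerm (sparsePaving h) A =
      ∑ c : Label g → Option ι, ∏ l, pavingFactor r H l (setAt A l) (c l) := by
  classical
  have := sparsePaving_finite h
  have hexp := Finset.prod_univ_sum (fun _ : Label g => (Finset.univ : Finset (Option ι)))
    (fun l o => pavingFactor r H l (setAt A l) o)
  rw [Fintype.piFinset_univ] at hexp
  rw [← hexp, tutteTerm]
  unfold pavingFactor
  refine Finset.prod_congr rfl fun l _ => ?_
  rw [← Finset.mul_sum, Fintype.sum_option, rk_ground_sparsePaving]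
  simp only [Option.elim]
  by_cases hl : setAt A l ∈ range H
  · obtain ⟨i, hi⟩ := hl
    have hc := h.ncard_eq _ ⟨i, rfl⟩
    have hpos := h.pos
    rw [rk_sparsePaving_of_mem h ⟨i, hi.symm ▸ rfl⟩, ← hi, hc]
    simp only [hH.eq_iff]
    rw [Finset.sum_ite_eq Finset.univ i, if_pos (Finset.mem_univ i)]
    rw [show r - (r - 1) = 1 by omega, show r - min r r = 0 by omega]
    ring
  · rw [rk_sparsePaving_of_notMem h (setAt_subset hA l) hl,
      Finset.sum_eq_zero fun i _ => if_neg fun hi => hl ⟨i, hi.symm⟩]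
    ring

end SparsePaving

/-! ### The even and odd parity matroids -/

/-- The elements of the matroids that witness the lower bound: the subsets of `Fin k`, and two
private elements for each index. -/
abbrev Elt (k : ℕ) : Type := Finset (Fin k) ⊕ (Fin k × Fin 2)

/-- The ground set: the subsets of `Fin k` of parity `p`, and all the private elements. -/
def parityGround (k : ℕ) (p : ZMod 2) : Set (Elt k) :=
  {x | Sum.elim (fun S => (S.card : ZMod 2) = p) (fun _ => True) x}

/-- The `i`-th circuit-hyperplane: the subsets that contain `i` and the private elements
of `i`. -/
def parityHyperplane {k : ℕ} (p : ZMod 2) (i : Fin k) : Set (Elt k) :=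
  {x | x ∈ parityGround k p ∧ Sum.elim (fun S => i ∈ S) (fun q => q.1 = i) x}

section

variable {k : ℕ} {p : ZMod 2} {i j : Fin k} {S : Finset (Fin k)} {q : Fin k × Fin 2}

@[simp] theorem inl_mem_parityGround :
    (Sum.inl S : Elt k) ∈ parityGround k p ↔ (S.card : ZMod 2) = p := Iff.rfl

@[simp] theorem inr_mem_parityGround : (Sum.inr q : Elt k) ∈ parityGround k p := trivial

@[simp] theorem inl_mem_parityHyperplane :
    (Sum.inl S : Elt k) ∈ parityHyperplane p i ↔ (S.card : ZMod 2) = p ∧ i ∈ S := Iff.rfl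

@[simp] theorem inr_mem_parityHyperplane :
    (Sum.inr q : Elt k) ∈ parityHyperplane p i ↔ q.1 = i := by
  simp [parityHyperplane]

theorem parityHyperplane_subset : parityHyperplane p i ⊆ parityGround k p := fun _ h => h.1

theorem eq_of_parityHyperplane_subset (h : parityHyperplane p i ⊆ parityHyperplane p j) :
    i = j := by
  have := h (show (Sum.inr (i, 0) : Elt k) ∈ parityHyperplane p i by simp)
  simpa using this

theorem parityHyperplane_injective : Function.Injective (parityHyperplane (k := k) p) :=
  fun _ _ h => eq_of_parityHyperplane_subset h.subset

/-- Flip the membership of `j` in the subsets of `Fin k`. -/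
def flip (j : Fin k) : Elt k → Elt k :=
  Sum.map (fun S => symmDiff S {j}) id

theorem flip_flip (j : Fin k) (x : Elt k) : flip j (flip j x) = x := by
  rcases x with S | q
  · simp [flip]
  · rfl

theorem card_symmDiff_singleton (S : Finset (Fin k)) (j : Fin k) :
    ((symmDiff S {j}).card : ZMod 2) = S.card + 1 := by
  by_cases hj : j ∈ S
  · have h1 : symmDiff S {j} = S.erase j := by
      ext x; simp only [Finset.mem_symmDiff, Finset.mem_singleton, Finset.mem_erase]; grind
    have h2 : (S.erase j).card + 1 = S.card := Finset.card_erase_add_one hj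
    rw [h1, ← h2]
    push_cast
    rw [add_assoc, show (1 + 1 : ZMod 2) = 0 from rfl, add_zero]
  · have h1 : symmDiff S {j} = insert j S := by
      ext x; simp only [Finset.mem_symmDiff, Finset.mem_singleton, Finset.mem_insert]; grind
    rw [h1, Finset.card_insert_of_notMem hj]
    push_cast
    rfl

theorem flip_mem_parityGround {j : Fin k} {x : Elt k} :
    flip j x ∈ parityGround k (p + 1) ↔ x ∈ parityGround k p := by
  rcases x with S | q
  · simp [flip, card_symmDiff_singleton]
  · simp [flip]

theorem flip_mem_parityHyperplane (hij : i ≠ j) {x : Elt k} :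
    flip j x ∈ parityHyperplane (p + 1) i ↔ x ∈ parityHyperplane p i := by
  rcases x with S | q
  · simp [flip, card_symmDiff_singleton, Finset.mem_symmDiff, hij]
  · simp [flip]

theorem flip_injective (j : Fin k) : Function.Injective (flip j) :=
  Function.LeftInverse.injective (flip_flip j)

theorem flip_image_flip_image (j : Fin k) (X : Set (Elt k)) : flip j '' (flip j '' X) = X := by
  rw [image_image]
  simp [flip_flip]

/-- Flipping `j` changes the parity of a subset but not whether it contains `i ≠ j`. -/
theorem flip_image_parityHyperplane (hij : i ≠ j) :
    flip j '' parityHyperplane p i = parityHyperplane (p + 1) i := by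
  ext x
  constructor
  · rintro ⟨y, hy, rfl⟩
    exact (flip_mem_parityHyperplane hij).2 hy
  · intro hx
    exact ⟨flip j x, (flip_mem_parityHyperplane hij).1 (by rwa [flip_flip]), flip_flip j x⟩

theorem flip_image_subset {j : Fin k} {X : Set (Elt k)} (hX : X ⊆ parityGround k p) :
    flip j '' X ⊆ parityGround k (p + 1) := by
  rintro _ ⟨x, hx, rfl⟩
  exact flip_mem_parityGround.2 (hX hx)

theorem ncard_parityHyperplane_add_one (hk : 2 ≤ k) :
    (parityHyperplane (p + 1) i).ncard = (parityHyperplane p i).ncard := by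
  have : Nontrivial (Fin k) := Fin.nontrivial_iff_two_le.2 hk
  obtain ⟨j, hj⟩ := exists_ne i
  rw [← flip_image_parityHyperplane hj.symm, ncard_image_of_injective _ (flip_injective j)]

theorem ncard_parityHyperplane_le :
    (parityHyperplane p i).ncard ≤ (parityHyperplane p j).ncard := by
  let e := Equiv.swap i j
  refine ncard_le_ncard_of_injOn (Sum.map (fun S => S.map e.toEmbedding) (Prod.map e id))
    ?_ ?_ (toFinite _)
  · rintro (S | q) h
    · simp only [inl_mem_parityHyperplane] at h
      simp only [Sum.map_inl, inl_mem_parityHyperplane, Finset.card_map]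
      exact ⟨h.1, Finset.mem_map.2 ⟨i, h.2, by simp [e]⟩⟩
    · simp only [inr_mem_parityHyperplane] at h
      simp [e, h]
  · exact (Function.Injective.sumMap (Finset.map_injective _)
      (Function.Injective.prodMap e.injective Function.injective_id)).injOn

theorem ncard_parityHyperplane_eq : (parityHyperplane p i).ncard = (parityHyperplane p j).ncard :=
  le_antisymm ncard_parityHyperplane_le ncard_parityHyperplane_le

theorem isSparse_parity (hk : 2 ≤ k) (j : Fin k) (p : ZMod 2) :
    IsSparse (parityGround k p) (parityHyperplane p j).ncard (range (parityHyperplane (k := k) p))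
    where
  finite := toFinite _
  pos := (ncard_pos (toFinite _)).2 ⟨Sum.inr (j, 0), by simp⟩
  lt_ncard := by
    refine ncard_lt_ncard (parityHyperplane_subset.ssubset_of_ne fun h => ?_) (toFinite _)
    have : Nontrivial (Fin k) := Fin.nontrivial_iff_two_le.2 hk
    obtain ⟨i, hi⟩ := exists_ne j
    have : (Sum.inr (i, 0) : Elt k) ∈ parityHyperplane p j := by rw [h]; simp
    exact hi (by simpa using this)
  subset := by
    rintro _ ⟨i, rfl⟩
    exact parityHyperplane_subset
  ncard_eq := by
    rintro _ ⟨i, rfl⟩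
    exact ncard_parityHyperplane_eq
  two_le := by
    rintro _ ⟨i, rfl⟩ _ ⟨i', rfl⟩ hne
    have hii : i ≠ i' := fun h => hne (h ▸ rfl)
    -- The two private elements of `i` lie in no other circuit-hyperplane; this is why each index
    -- has two.
    rw [← ncard_pair (show (Sum.inr (i, 0) : Elt k) ≠ Sum.inr (i, 1) by simp)]
    refine ncard_le_ncard (pair_subset ?_ ?_) (toFinite _) <;> simp [hii]

/-- The sparse paving matroid on `parityGround k p` with the given circuit-hyperplanes. -/
noncomputable def parityMatroid (hk : 2 ≤ k) (p : ZMod 2) : Matroid (Elt k) :=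
  sparsePaving (isSparse_parity hk ⟨0, by omega⟩ p)

instance (hk : 2 ≤ k) : (parityMatroid hk p).Finite := sparsePaving_finite _

theorem pavingFactor_map {α β ι : Type*} {g r : ℕ} {H : ι → Set α} {H' : ι → Set β}
    {T : Set α → Set β} {X : Set α} (hc : (T X).ncard = X.ncard) {o : Option ι}
    (hH : ∀ i ∈ o, T X = H' i ↔ X = H i) (l : Label g) :
    pavingFactor r H l X o = pavingFactor r H' l (T X) o := by
  unfold pavingFactor
  rw [hc]
  cases o with
  | none => rfl
  | some i => simp only [Option.elim, hH i rfl]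

/-- `g` sets and their pairwise intersections and unions cannot comprise all of `g + 1`
circuit-hyperplanes. -/
theorem exists_forall_setAt_ne {g : ℕ} (hg : 0 < g) (p : ZMod 2)
    (A : Fin g → Set (Elt (g + 1))) :
    ∃ j : Fin (g + 1), ∀ l, setAt A l ≠ parityHyperplane p j := by
  by_contra! hall
  let H := parityHyperplane (k := g + 1) p
  have anti : ∀ {i j}, H i ⊆ H j → i = j := fun h => eq_of_parityHyperplane_subset h
  let uses : Fin g → Fin (g + 1) → Prop := fun i j => H j = A i ∨
    (∃ m, m ≠ i ∧ H j = A i ∩ A m) ∨ ∃ m, m ≠ i ∧ H j = A i ∪ A m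
  have hseen : ∀ j, (∃ i, H j = A i) ∨ (∃ i m, m ≠ i ∧ H j = A i ∩ A m) ∨
      ∃ i m, m ≠ i ∧ H j = A i ∪ A m := by
    intro j
    obtain ⟨l, hl⟩ := hall j
    match l, hl with
    | Sum.inl i, hl => exact Or.inl ⟨i, hl.symm⟩
    | Sum.inr (Sum.inl q), hl => exact Or.inr (Or.inl ⟨q.1.1, q.1.2, q.2.ne', hl.symm⟩)
    | Sum.inr (Sum.inr q), hl => exact Or.inr (Or.inr ⟨q.1.1, q.1.2, q.2.ne', hl.symm⟩)
  have priv : ∀ j, (Sum.inr (j, 0) : Elt (g + 1)) ∈ H j := fun j => by simp [H]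
  have priv' : ∀ {i j}, (Sum.inr (i, 0) : Elt (g + 1)) ∈ H j → i = j := fun h => by
    simpa [H] using h
  have hunion : ∀ {i m j j'}, m ≠ i → H j = A i ∪ A m → uses i j' → j' ≠ j → A i ⊆ H j' := by
    rintro i m j j' - hj (h | ⟨m', -, h⟩ | ⟨m', -, h⟩) hne
    · exact h.superset
    · exact absurd (anti (by rw [h, hj]; exact inter_subset_left.trans subset_union_left)) hne
    · rw [h]; exact subset_union_left
  have hinter : ∀ {i m j j'}, m ≠ i → H j = A i ∩ A m → uses i j' → j' ≠ j →
      H j' ⊆ A i ∧ ∃ m', m' ≠ i ∧ m' ≠ m := by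
    rintro i m j j' - hj (h | ⟨m', hm', h⟩ | ⟨m', -, h⟩) hne
    · exact absurd (anti (by rw [h, hj]; exact inter_subset_left)).symm hne
    · refine ⟨by rw [h]; exact inter_subset_left, m', hm', ?_⟩
      rintro rfl
      exact hne (anti (h.trans hj.symm).subset)
    · exact absurd (anti (by rw [h, hj]; exact inter_subset_left.trans subset_union_left)).symm hne
  -- Every circuit-hyperplane has a position in the tuple that serves it alone. This injects `g + 1`
  -- indices into `g` positions.
  have hrep : ∀ j, ∃ i, uses i j ∧ ∀ j', uses i j' → j' = j := by
    intro j
    rcases hseen j with ⟨i, hi⟩ | ⟨i, m, hne, h⟩ | ⟨i, m, hne, h⟩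
    · refine ⟨i, Or.inl hi, ?_⟩
      rintro j' (h | ⟨m, -, h⟩ | ⟨m, -, h⟩)
      · exact anti (h.trans hi.symm).subset
      · exact anti (by rw [h, hi]; exact inter_subset_left)
      · exact (anti (by rw [h, hi]; exact subset_union_left)).symm
    · have u1 : uses i j := Or.inr (Or.inl ⟨m, hne, h⟩)
      have u2 : uses m j := Or.inr (Or.inl ⟨i, hne.symm, by rw [h, inter_comm]⟩)
      by_contra! hcon
      obtain ⟨j₁, hj₁, hne₁⟩ := hcon i u1
      obtain ⟨j₂, hj₂, hne₂⟩ := hcon m u2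
      obtain ⟨s1, m', hm1, hm2⟩ := hinter hne h hj₁ hne₁
      obtain ⟨s2, -⟩ := hinter hne.symm (by rw [h, inter_comm]) hj₂ hne₂
      have hsub : H j₁ ∩ H j₂ ⊆ H j := by rw [h]; exact inter_subset_inter s1 s2
      by_cases h12 : j₁ = j₂
      · subst h12
        exact hne₁ (priv' (hsub ⟨priv j₁, priv j₁⟩))
      -- Here `H j₁ ∩ H j₂ ⊆ H j`. A subset containing `j₁` and `j₂` but not `j` refutes this; for
      -- odd parity it needs a fourth index, available because the second intersection uses a third
      -- position.
      have hg3 : 3 ≤ g := by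
        have h1 := i.2
        have h2 := m.2
        have h3 := m'.2
        rw [← Fin.val_ne_iff] at hm1 hm2 hne
        omega
      obtain ⟨x, hx⟩ : ∃ x : Fin (g + 1), x ∉ ({j, j₁, j₂} : Finset (Fin (g + 1))) := by
        by_contra! hall
        have h1 : ({j, j₁, j₂} : Finset (Fin (g + 1))) = Finset.univ :=
          Finset.eq_univ_iff_forall.2 hall
        have h2 := Finset.card_le_three (a := j) (b := j₁) (c := j₂)
        rw [h1, Finset.card_univ, Fintype.card_fin] at h2
        omega
      simp only [Finset.mem_insert, Finset.mem_singleton, not_or] at hx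
      have hc2 : ({j₁, j₂} : Finset (Fin (g + 1))).card = 2 := Finset.card_pair h12
      obtain ⟨S, hS, hS1, hS2, hSj⟩ : ∃ S : Finset (Fin (g + 1)), (S.card : ZMod 2) = p ∧
          j₁ ∈ S ∧ j₂ ∈ S ∧ j ∉ S := by
        have hp : ∀ p : ZMod 2, p = 0 ∨ p = 1 := by decide
        rcases hp p with rfl | rfl
        · refine ⟨{j₁, j₂}, by rw [hc2]; rfl, by simp, by simp, ?_⟩
          simp [hne₁.symm, hne₂.symm]
        · refine ⟨insert x {j₁, j₂}, ?_, by simp, by simp, ?_⟩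
          · rw [Finset.card_insert_of_notMem (by simp [hx.2.1, hx.2.2]), hc2]; rfl
          · simp [hne₁.symm, hne₂.symm, Ne.symm hx.1]
      have : (Sum.inl S : Elt (g + 1)) ∈ H j := hsub ⟨⟨hS, hS1⟩, ⟨hS, hS2⟩⟩
      exact hSj this.2
    · have u1 : uses i j := Or.inr (Or.inr ⟨m, hne, h⟩)
      have u2 : uses m j := Or.inr (Or.inr ⟨i, hne.symm, by rw [h, union_comm]⟩)
      by_contra! hcon
      obtain ⟨j₁, hj₁, hne₁⟩ := hcon i u1
      obtain ⟨j₂, hj₂, hne₂⟩ := hcon m u2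
      have s1 := hunion hne h hj₁ hne₁
      have s2 := hunion hne.symm (by rw [h, union_comm]) hj₂ hne₂
      have hm : (Sum.inr (j, 0) : Elt (g + 1)) ∈ A i ∪ A m := h ▸ priv j
      rcases hm with hm | hm
      · exact hne₁ (priv' (s1 hm)).symm
      · exact hne₂ (priv' (s2 hm)).symm
  choose f hf using hrep
  have hinj : Function.Injective f := fun j j' hjj =>
    (hf j' |>.2 j (hjj ▸ (hf j).1))
  have := Fintype.card_le_of_injective f hinj
  simp at this

/-- Compare the expansions choice by choice. A choice that omits some `j` is matched by flipping
`j`; one that uses every index contributes zero on both sides. -/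
theorem tutte_parityMatroid_eq {g : ℕ} (hg : 0 < g) :
    tutte g (parityMatroid (k := g + 1) (by omega) 0) =
      tutte g (parityMatroid (k := g + 1) (by omega) 1) := by
  classical
  have hk : 2 ≤ g + 1 := by omega
  set r := (parityHyperplane (k := g + 1) 0 ⟨0, by omega⟩).ncard with hr
  have hr1 : (parityHyperplane (k := g + 1) 1 ⟨0, by omega⟩).ncard = r :=
    ncard_parityHyperplane_add_one (p := 0) hk
  have expand : ∀ p : ZMod 2, (parityHyperplane (k := g + 1) p ⟨0, by omega⟩).ncard = r →
      tutte g (parityMatroid (k := g + 1) hk p) =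
      ∑ c : Label g → Option (Fin (g + 1)), tupleSum g (toFinite (parityGround (g + 1) p))
        fun A => ∏ l, pavingFactor r (parityHyperplane p) l (setAt A l) (c l) := by
    intro p hp
    rw [tutte_eq_tupleSum]
    refine (tupleSum_congr (toFinite (parityGround (g + 1) p)) fun A hA =>
      tutteTerm_sparsePaving parityHyperplane_injective
        (isSparse_parity hk ⟨0, by omega⟩ p) hA).trans ?_
    rw [hp]
    unfold tupleSum
    rw [Finset.sum_comm]
  rw [expand 0 rfl, expand 1 hr1]
  refine Finset.sum_congr rfl fun c _ => ?_
  by_cases hc : ∃ j, ∀ l, c l ≠ some j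
  · obtain ⟨j, hj⟩ := hc
    refine tupleSum_map (T := fun X => flip j '' X) (T' := fun X => flip j '' X) _ _
      (fun X hX => flip_image_subset (p := 0) hX)
      (fun X hX => flip_image_subset (p := 1) hX) (fun X _ => flip_image_flip_image j X)
      (fun X _ => flip_image_flip_image j X) fun A hA => ?_
    refine Finset.prod_congr rfl fun l _ => ?_
    rw [setAt_map (T := fun X => flip j '' X) (fun X Y => image_inter (flip_injective j))
      (fun X Y => image_union _ _ _)]
    refine pavingFactor_map (T := fun X => flip j '' X)
      (ncard_image_of_injective _ (flip_injective j)) (fun i hi => ?_) l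
    have hij : i ≠ j := fun h => hj l (h ▸ hi)
    have := flip_image_parityHyperplane (p := 0) hij
    rw [zero_add] at this
    rw [← this]
    exact (flip_injective j).image_injective.eq_iff
  · push Not at hc
    have hzero : ∀ (p : ZMod 2) (A : Fin g → Set (Elt (g + 1))),
        ∏ l, pavingFactor r (parityHyperplane p) l (setAt A l) (c l) = 0 := by
      intro p A
      obtain ⟨j, hj⟩ := exists_forall_setAt_ne hg p A
      obtain ⟨l, hl⟩ := hc j
      refine Finset.prod_eq_zero (Finset.mem_univ l) ?_
      rw [hl]
      simp [pavingFactor, hj l]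
    simp only [hzero, tupleSum, Finset.sum_const_zero]

end

/-! ### Telling the parity matroids apart -/

section

variable {k : ℕ} {p : ZMod 2}

theorem parityMatroid_ground (hk : 2 ≤ k) : (parityMatroid hk p).E = parityGround k p := rfl

theorem rk_parityHyperplane (hk : 2 ≤ k) (i : Fin k) :
    rk (parityMatroid hk p) (parityHyperplane p i) = (parityHyperplane p i).ncard - 1 := by
  rw [ncard_parityHyperplane_eq (i := i) (j := ⟨0, by omega⟩)]
  exact rk_sparsePaving_of_mem _ ⟨i, rfl⟩

theorem ncard_parityHyperplane_zero_one (hk : 2 ≤ k) (i j : Fin k) :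
    (parityHyperplane 1 i).ncard = (parityHyperplane 0 j).ncard := by
  rw [ncard_parityHyperplane_eq (i := i) (j := j)]
  exact ncard_parityHyperplane_add_one (p := 0) hk

theorem exists_eq_parityHyperplane (hk : 2 ≤ k) {X : Set (Elt k)} (hX : X ⊆ parityGround k p)
    (i : Fin k) (hc : X.ncard = (parityHyperplane p i).ncard)
    (hr : rk (parityMatroid hk p) X = (parityHyperplane p i).ncard - 1) :
    ∃ j, X = parityHyperplane p j := by
  rw [ncard_parityHyperplane_eq (i := i) (j := ⟨0, by omega⟩)] at hc hr
  obtain ⟨j, hj⟩ := mem_of_rk_eq (isSparse_parity hk ⟨0, by omega⟩ p) hX hc hr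
  exact ⟨j, hj.symm⟩

end

/-- The two odd circuit-hyperplanes are disjoint, while both even ones contain the element `{0, 1}`.
-/
theorem whitney_parityMatroid_two_ne {h : ℕ} (hh : 2 ≤ h) :
    whitney h (parityMatroid (k := 2) le_rfl 0) ≠ whitney h (parityMatroid (k := 2) le_rfl 1) := by
  intro heq
  let H₁ := parityHyperplane (k := 2) 1
  obtain ⟨Φ, hΦ, hdata⟩ := exists_map_of_whitney_eq (by omega) heq (𝒜 := range H₁) (finite_range _)
    (by
      have := ncard_image_le (f := H₁) (s := univ) (toFinite _)
      rw [image_univ, ncard_univ, Nat.card_eq_fintype_card, Fintype.card_fin] at this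
      omega)
    (by rintro _ ⟨i, rfl⟩; exact parityHyperplane_subset)
  have himg : ∀ i, ∃ j, Φ (H₁ i) = parityHyperplane 0 j := by
    intro i
    have hd := hdata _ ⟨i, rfl⟩ _ ⟨i, rfl⟩
    simp only [inter_self, union_self] at hd
    refine exists_eq_parityHyperplane le_rfl (hΦ _ ⟨i, rfl⟩) i ?_ ?_
    · rw [hd.1, ncard_parityHyperplane_zero_one le_rfl i i]
    · rw [hd.2.2.1, rk_parityHyperplane, ncard_parityHyperplane_zero_one le_rfl i i]
  obtain ⟨a, ha⟩ := himg 0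
  obtain ⟨b, hb⟩ := himg 1
  have hd := (hdata _ ⟨0, rfl⟩ _ ⟨1, rfl⟩).1
  have hempty : H₁ 0 ∩ H₁ 1 = ∅ := by
    rw [eq_empty_iff_forall_notMem]
    rintro (S | q) ⟨h1, h2⟩
    · simp only [H₁, inl_mem_parityHyperplane] at h1 h2
      revert S
      decide
    · simp only [H₁, inr_mem_parityHyperplane] at h1 h2
      exact absurd (h1.symm.trans h2) (by decide)
  rw [hempty, ha, hb, ncard_empty, ncard_eq_zero (toFinite _)] at hd
  have : (Sum.inl Finset.univ : Elt 2) ∈ parityHyperplane 0 a ∩ parityHyperplane 0 b := by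
    constructor <;> simp <;> rfl
  rw [hd] at this
  exact this

/-- Pairwise sizes of the `H i` do not separate the parities here, so triple intersections must be
reached. The three odd circuit-hyperplanes are written as pairwise intersections of three sets; then
any two meet inside the third, whereas the even element `{a, b}` lies only in `H a` and `H b`. -/
theorem whitney_parityMatroid_three_ne {h : ℕ} (hh : 3 ≤ h) :
    whitney h (parityMatroid (k := 3) (by omega) 0) ≠
      whitney h (parityMatroid (k := 3) (by omega) 1) := by
  intro heq
  have hk : 2 ≤ 3 := by omega
  let H₁ := parityHyperplane (k := 3) 1
  let H₀ := parityHyperplane (k := 3) 0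
  have anti : ∀ {i j}, H₀ i ⊆ H₀ j → i = j := fun h => eq_of_parityHyperplane_subset h
  let A : Fin 3 → Set (Elt 3) := fun i => {x | ∃ j, j ≠ i ∧ x ∈ H₁ j}
  have hAE : ∀ i, A i ⊆ parityGround 3 1 := by
    rintro i x ⟨j, -, hx⟩
    exact parityHyperplane_subset hx
  obtain ⟨Φ, hΦ, hdata⟩ := exists_map_of_whitney_eq (by omega) heq (𝒜 := range A) (finite_range _)
    (by
      have := ncard_image_le (f := A) (s := univ) (toFinite _)
      rw [image_univ, ncard_univ, Nat.card_eq_fintype_card, Fintype.card_fin] at this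
      omega)
    (by rintro _ ⟨i, rfl⟩; exact hAE i)
  have hA : ∀ i j l : Fin 3, i ≠ j → l ≠ i → l ≠ j → A i ∩ A j = H₁ l := by
    intro i j l hij hli hlj
    ext x
    constructor
    · rintro ⟨⟨a, ha, hxa⟩, b, hb, hxb⟩
      rcases x with S | q
      · simp only [H₁, inl_mem_parityHyperplane] at hxa hxb ⊢
        revert S i j l a b
        decide
      · simp only [H₁, inr_mem_parityHyperplane] at hxa hxb ⊢
        omega
    · intro hx
      exact ⟨⟨l, hli, hx⟩, l, hlj, hx⟩
  have hU : A 0 ∪ A 1 = parityGround 3 1 := by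
    refine (union_subset (hAE 0) (hAE 1)).antisymm ?_
    rintro (S | q) hx
    · rw [inl_mem_parityGround] at hx
      have : ∃ s, s ∈ S := by
        revert S
        decide
      obtain ⟨s, hs⟩ := this
      by_cases h0 : s = 0
      · exact Or.inr ⟨s, by rw [h0]; decide, hx, hs⟩
      · exact Or.inl ⟨s, h0, hx, hs⟩
    · by_cases h0 : q.1 = 0
      · exact Or.inr ⟨q.1, by rw [h0]; decide, by simp [H₁]⟩
      · exact Or.inl ⟨q.1, h0, by simp [H₁]⟩
  have himg : ∀ i j l : Fin 3, i ≠ j → l ≠ i → l ≠ j →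
      ∃ c, Φ (A i) ∩ Φ (A j) = H₀ c := by
    intro i j l hij hli hlj
    have hd := hdata _ ⟨i, rfl⟩ _ ⟨j, rfl⟩
    rw [hA i j l hij hli hlj] at hd
    refine exists_eq_parityHyperplane hk (inter_subset_left.trans (hΦ _ ⟨i, rfl⟩)) l ?_ ?_
    · rw [hd.1, ncard_parityHyperplane_zero_one hk l l]
    · rw [hd.2.2.1, rk_parityHyperplane, ncard_parityHyperplane_zero_one hk l l]
  obtain ⟨a, ha⟩ := himg 0 1 2 (by decide) (by decide) (by decide)
  obtain ⟨b, hb⟩ := himg 0 2 1 (by decide) (by decide) (by decide)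
  obtain ⟨c, hc⟩ := himg 1 2 0 (by decide) (by decide) (by decide)
  have hab : H₀ a ∩ H₀ b ⊆ H₀ c := by
    rw [← ha, ← hb, ← hc]
    exact fun x hx => ⟨hx.1.2, hx.2.2⟩
  have hac : H₀ a ∩ H₀ c ⊆ H₀ b := by
    rw [← ha, ← hb, ← hc]
    exact fun x hx => ⟨hx.1.1, hx.2.2⟩
  have hE := ncard_ground_eq_of_whitney_eq (by omega) heq
  rw [parityMatroid_ground, parityMatroid_ground] at hE
  have hΦU : Φ (A 0) ∪ Φ (A 1) = parityGround 3 0 := by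
    refine eq_of_subset_of_ncard_le (union_subset (hΦ _ ⟨0, rfl⟩) (hΦ _ ⟨1, rfl⟩)) ?_ (toFinite _)
    rw [(hdata _ ⟨0, rfl⟩ _ ⟨1, rfl⟩).2.1, hU, hE]
  -- If the three images coincide, covering the ground set by `Φ (A 0)` and `Φ (A 1)` squeezes `Φ (A
  -- 2)` down to a single circuit-hyperplane, which is too small.
  by_cases h1 : a = b
  · have hca : a = c := anti (by rwa [← h1, inter_self] at hab)
    have h2 : Φ (A 2) = H₀ a := by
      apply Subset.antisymm
      · intro x hx
        have hxU : x ∈ Φ (A 0) ∪ Φ (A 1) := by rw [hΦU]; exact hΦ _ ⟨2, rfl⟩ hx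
        rcases hxU with h | h
        · rw [h1, ← hb]; exact ⟨h, hx⟩
        · rw [hca, ← hc]; exact ⟨h, hx⟩
      · rw [h1, ← hb]; exact inter_subset_right
    have hd := (hdata _ ⟨2, rfl⟩ _ ⟨2, rfl⟩).1
    rw [inter_self, inter_self, h2] at hd
    have hlt : (H₁ 0).ncard < (A 2).ncard := by
      refine ncard_lt_ncard ⟨fun x hx => ⟨0, by decide, hx⟩, fun hsub => ?_⟩ (toFinite _)
      have : (Sum.inr (1, 0) : Elt 3) ∈ H₁ 0 := hsub ⟨1, by decide, by simp [H₁]⟩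
      simp [H₁] at this
    rw [← hd, ncard_parityHyperplane_zero_one hk 0 a] at hlt
    exact lt_irrefl _ hlt
  · have hmem : (Sum.inl {a, b} : Elt 3) ∈ H₀ c := hab (by
      have : ((({a, b} : Finset (Fin 3)).card : ℕ) : ZMod 2) = 0 := by
        rw [Finset.card_pair h1]; rfl
      exact ⟨⟨this, by simp⟩, ⟨this, by simp⟩⟩)
    have hcab := hmem.2
    simp only [Sum.elim_inl, Finset.mem_insert, Finset.mem_singleton] at hcab
    rcases hcab with rfl | rfl
    · rw [inter_self] at hac
      exact h1 (anti hac)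
    · have hba : H₀ c ∩ H₀ c ⊆ H₀ a := by
        conv_lhs => rw [← hb]
        intro x hx
        have : x ∈ H₀ c := by rw [← hb]; exact hx.1
        rw [← hc] at this
        rw [← ha]
        exact ⟨hx.1.1, this.1⟩
      rw [inter_self] at hba
      exact h1 (anti hba).symm

/-- The even circuit-hyperplanes all fit into a proper subset of the ground set, since the element
`∅` lies in none of them. The odd ones cover theirs. -/
theorem whitney_parityMatroid_ne_of_le {k h : ℕ} (hk : 2 ≤ k) (hh : k + 1 ≤ h) :
    whitney h (parityMatroid hk 1) ≠ whitney h (parityMatroid hk 0) := by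
  intro heq
  let H₀ := parityHyperplane (k := k) 0
  set X : Set (Elt k) := parityGround k 0 \ {Sum.inl ∅} with hX
  obtain ⟨Φ, hΦ, hdata⟩ := exists_map_of_whitney_eq (by omega) heq (𝒜 := insert X (range H₀))
    (toFinite _)
    (by
      have := ncard_image_le (f := H₀) (s := univ) (toFinite _)
      rw [image_univ, ncard_univ, Nat.card_eq_fintype_card, Fintype.card_fin] at this
      exact (ncard_insert_le _ _).trans (by omega))
    (by
      rintro _ (rfl | ⟨i, rfl⟩)
      exacts [sdiff_subset, parityHyperplane_subset])
  have mH : ∀ i, H₀ i ∈ insert X (range H₀) := fun i => Or.inr ⟨i, rfl⟩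
  have mX : X ∈ insert X (range H₀) := Or.inl rfl
  have himg : ∀ i, ∃ j, Φ (H₀ i) = parityHyperplane 1 j := by
    intro i
    have hd := hdata _ (mH i) _ (mH i)
    simp only [inter_self, union_self] at hd
    refine exists_eq_parityHyperplane hk (hΦ _ (mH i)) i ?_ ?_
    · rw [hd.1, ncard_parityHyperplane_zero_one hk i i]
    · rw [hd.2.2.1, rk_parityHyperplane, ncard_parityHyperplane_zero_one hk i i]
  choose π hπ using himg
  have hπinj : Function.Injective π := by
    intro i j hij
    have hd := (hdata _ (mH i) _ (mH j)).1
    rw [hπ, hπ, hij, inter_self, ncard_parityHyperplane_zero_one hk _ i] at hd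
    have : H₀ i ∩ H₀ j = H₀ i := eq_of_subset_of_ncard_le inter_subset_left hd.le (toFinite _)
    exact eq_of_parityHyperplane_subset (inter_eq_left.1 this)
  have hπsurj := Finite.surjective_of_injective hπinj
  have hHX : ∀ i, H₀ i ⊆ X := by
    intro i x hx
    refine ⟨parityHyperplane_subset hx, ?_⟩
    rintro rfl
    simp [H₀] at hx
  have hsub : ∀ j, parityHyperplane 1 j ⊆ Φ X := by
    intro j
    obtain ⟨i, rfl⟩ := hπsurj j
    have hd := (hdata _ (mH i) _ mX).1
    rw [inter_eq_left.2 (hHX i), hπ, ← ncard_parityHyperplane_zero_one hk (π i) i] at hd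
    exact inter_eq_left.1 (eq_of_subset_of_ncard_le inter_subset_left hd.ge (toFinite _))
  have hall : parityGround k 1 ⊆ Φ X := by
    rintro (S | q) hx
    · rw [inl_mem_parityGround] at hx
      obtain ⟨s, hs⟩ : S.Nonempty := by
        rw [Finset.nonempty_iff_ne_empty]
        rintro rfl
        simp at hx
      exact hsub s ⟨hx, hs⟩
    · exact hsub q.1 (by simp)
  have hd := (hdata _ mX _ mX).1
  rw [inter_self, inter_self] at hd
  have hE := ncard_ground_eq_of_whitney_eq (by omega) heq
  rw [parityMatroid_ground, parityMatroid_ground] at hE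
  have h1 := ncard_le_ncard hall (toFinite _)
  have h2 := ncard_sdiff_singleton_add_one (s := parityGround k 0) (a := Sum.inl ∅) (by simp)
    (toFinite _)
  rw [← hX] at h2
  omega

theorem add_one_le_ceil_sqrt_two_mul {g : ℕ} (hg : 0 < g) : g + 1 ≤ ⌈√2 * (g : ℝ)⌉₊ := by
  rw [Nat.add_one_le_iff, Nat.lt_ceil]
  have h1 : (1 : ℝ) < √2 := by
    rw [Real.lt_sqrt] <;> norm_num
  have h2 : (0 : ℝ) < g := by exact_mod_cast hg
  nlinarith

theorem add_two_le_ceil_sqrt_two_mul {g : ℕ} (hg : 3 ≤ g) : g + 2 ≤ ⌈√2 * (g : ℝ)⌉₊ := by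
  rw [show g + 2 = (g + 1) + 1 from rfl, Nat.add_one_le_iff, Nat.lt_ceil]
  -- `0.4 * g > 1` holds from `g = 3` on; smaller `g` need the special families.
  have h1 : (1.4 : ℝ) < √2 := by
    rw [Real.lt_sqrt] <;> norm_num
  have h2 : (3 : ℝ) ≤ g := by exact_mod_cast hg
  push_cast
  nlinarith

theorem tutte_parityMatroid_ne {g : ℕ} (hg : 0 < g) :
    tutte ⌈√2 * (g : ℝ)⌉₊ (parityMatroid (k := g + 1) (by omega) 0) ≠
      tutte ⌈√2 * (g : ℝ)⌉₊ (parityMatroid (k := g + 1) (by omega) 1) := by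
  intro heq
  have hle := add_one_le_ceil_sqrt_two_mul hg
  rcases (by omega : g = 1 ∨ g = 2 ∨ 3 ≤ g) with rfl | rfl | h3
  · exact whitney_parityMatroid_two_ne hle (whitney_congr heq)
  · exact whitney_parityMatroid_three_ne hle (whitney_congr heq)
  · exact whitney_parityMatroid_ne_of_le (by omega) (add_two_le_ceil_sqrt_two_mul h3)
      (whitney_congr heq.symm)

end GenusTutte

theorem theorem1p1 :
    -- (1) a matroid is determined up to isomorphism by its Tutte polynomial of genus `|B(M)|`
    (∀ (α : Type u) (β : Type v) (M : Matroid α) (N : Matroid β) [M.Finite] [N.Finite],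
      GenusTutte.tutte (GenusTutte.numBases M) N = GenusTutte.tutte (GenusTutte.numBases M) M →
        GenusTutte.Iso M N) ∧
    -- `T^(g)` is a complete invariant of the matroids with at most `g` bases
    (∀ (g : ℕ) (α : Type u) (β : Type v) (M : Matroid α) (N : Matroid β) [M.Finite] [N.Finite],
      GenusTutte.numBases M ≤ g → GenusTutte.numBases N ≤ g →
        (GenusTutte.tutte g M = GenusTutte.tutte g N ↔ GenusTutte.Iso M N)) ∧
    -- the non-separable form, with the Whitney rank generating function
    (∀ (α : Type u) (β : Type v) (M : Matroid α) (N : Matroid β) [M.Finite] [N.Finite],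
      ¬ GenusTutte.Separable M →
      GenusTutte.whitney (GenusTutte.numBases M) N =
        GenusTutte.whitney (GenusTutte.numBases M) M →
        GenusTutte.Iso M N) ∧
    -- (2)
    (∀ g : ℕ, 0 < g →
      ∃ (α β : Type) (M : Matroid α) (N : Matroid β) (_ : M.Finite) (_ : N.Finite),
        GenusTutte.tutte g M = GenusTutte.tutte g N ∧
        GenusTutte.tutte ⌈Real.sqrt 2 * (g : ℝ)⌉₊ M ≠
          GenusTutte.tutte ⌈Real.sqrt 2 * (g : ℝ)⌉₊ N) := by
  refine ⟨?_, ?_, ?_, ?_⟩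
  · intro α β M N _ _ h
    exact GenusTutte.iso_of_whitney_eq le_rfl (GenusTutte.whitney_congr h)
  · intro g α β M N _ _ hM _
    exact ⟨fun h => GenusTutte.iso_of_whitney_eq hM (GenusTutte.whitney_congr h.symm),
      GenusTutte.tutte_eq_of_iso g⟩
  · intro α β M N _ _ _ h
    exact GenusTutte.iso_of_whitney_eq le_rfl h
  · intro g hg
    exact ⟨_, _, _, _, inferInstance, inferInstance, GenusTutte.tutte_parityMatroid_eq hg,
      GenusTutte.tutte_parityMatroid_ne hg⟩
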